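/- **Theorem 3.6.** Let $X_1,\dots,X_n$ be mutually independent random variables (with arbitrary measurable value spaces and laws), and let $A_1,\dots,A_m$ be events such that $A_i$ is determined by the variables in a set $\mathrm{vbl}(A_i)\subseteq\{X_1,\dots,X_n\}$; put $p_i=\Pr(A_i)$. Let $G_D=([m],E_D)$ be the canonical dependency graph: for $i\neq i'$, $(i,i')\in E_D$ iff $\mathrm{vbl}(A_i)\cap \mathrm{vbl}(A_{i'})\neq\emptyset$. Let $\mathcal M\subseteq E_D$ be a matching of $G_D$, and for each $(i,i')\in\mathcal M$ let $\delta_{i,i'}=\delta_{i',i}\in(0,1)$ satisfy $\Pr(A_i\cap A_{i'})\ge \delta_{i,i'}$. For each $i$ covered by $\mathcal M$, with partner $i'$, put $$p_i' = p_i-\frac{\delta_{i,i'}^2}{8\,p_{i'}} .$$ The Moser–Tardos (MT) algorithm first draws independent values for $X_1,\dots,X_n$; then, as long as some $A_i$ holds under the current assignment, it selects one such $i$ by an arbitrary selection rule (possibly randomized and depending on the history of the run) and resamples all variables in $\mathrm{vbl}(A_i)$ with fresh independent values. Let $T\in\{0,1,2,\dots\}\cup\{\infty\}$ be the number of resampling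 steps. A witness DAG of $G_D$ is a finite directed acyclic graph $D$ whose nodes $v$ carry labels $L(v)\in[m]$, such that two distinct nodes $u,v$ are joined by an arc (in either direction) if and only if $L(u)=L(v)$ or $(L(u),L(v))\in E_D$. It is proper if it has exactly one sink. Let $\mathcal D(G_D)$ be the set of proper witness DAGs of $G_D$, up to label-preserving isomorphism. An arc $u\to v$ of $D$ is $\mathcal M$-reversible if $(L(u),L(v))\in\mathcal M$ and replacing $u\to v$ by $v\to u$ leaves $D$ acyclic. Let $\mathcal V(D)$ be the set of nodes of $D$ that are an endpoint of some $\mathcal M$-reversible arc, and $\overline{\mathcal V}(D)$ the set of the other nodes of $D$. Then, for every selection rule, $$\mathbb E[T]\;\le\;\sum_{D\in\mathcal D(G_D)}\Bigl(\prod_{v\in\overline{\mathcal V}(D)}p_{L(v)}\Bigr)\Bigl(\prod_{v\in\mathcal V(D)}p'_{L(v)}\Bigr),$$ as an inequality in $[0,\infty]$. -/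

import Mathlib

open MeasureTheory
open scoped ENNReal

/-- A variable-generated event system: independent random variables indexed by `κ`, where the
variable `j` takes values in `X j` with law `μ j`, and events indexed by `ι`, where the event
`event i` is determined by the variables in `vbl i`. The joint law is `Measure.pi μ`. -/
structure VarSystem (ι : Type*) {κ : Type*} [Fintype κ] (X : κ → Type*)
    [∀ j, MeasurableSpace (X j)] where
  μ : ∀ j, Measure (X j)
  isProb : ∀ j, IsProbabilityMeasure (μ j)
  vbl : ι → Set κ
  event : ι → Set (∀ j, X j)
  measurableSet_event : ∀ i, MeasurableSet (event i)
  event_congr : ∀ i (x y : ∀ j, X j), (∀ j ∈ vbl i, x j = y j) → (x ∈ event i ↔ y ∈ event i)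

namespace VarSystem

variable {ι : Type*} {κ : Type*} [Fintype κ] {X : κ → Type*} [∀ j, MeasurableSpace (X j)]

attribute [instance] VarSystem.isProb

/-- The joint law of the independent variables. -/
noncomputable def law (S : VarSystem ι X) : Measure (∀ j, X j) := Measure.pi S.μ

instance (S : VarSystem ι X) : IsProbabilityMeasure S.law := by
  unfold law; infer_instance

/-- The probability `p i` of the event `i`. -/
noncomputable def prob (S : VarSystem ι X) (i : ι) : ℝ := S.law.real (S.event i)

/-- The canonical dependency graph: distinct events are adjacent iff they share a variable. -/
def depGraph (S : VarSystem ι X) : SimpleGraph ι where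
  Adj i i' := i ≠ i' ∧ ∃ j, j ∈ S.vbl i ∧ j ∈ S.vbl i'
  symm := ⟨fun _ _ h => ⟨h.1.symm, h.2.imp fun _ hj => ⟨hj.2, hj.1⟩⟩⟩
  loopless := ⟨fun _ h => h.1 rfl⟩

open Classical in
/-- The reduced probability `p' i = p i - δ(i,i')² / (8 p i')`, where `i'` is the partner of `i`
in the matching `M` (vertices outside the matching keep the value `p i`). -/
noncomputable def probReduced (S : VarSystem ι X) (M : S.depGraph.Subgraph) (δ : Sym2 ι → ℝ)
    (i : ι) : ℝ :=
  if h : ∃ i', M.Adj i i' then S.prob i - δ s(i, h.choose) ^ 2 / (8 * S.prob h.choose)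
  else S.prob i

/-- A (possibly randomized) selection rule for the Moser-Tardos algorithm: after `n` resampling
steps it picks an event from a random seed and the history of all assignments so far. Whenever
some event holds under the current assignment, the selected event must hold under it. -/
structure SelectionRule (S : VarSystem ι X) (R : Type*) [MeasurableSpace R] where
  select : (n : ℕ) → R → (Fin (n + 1) → ∀ j, X j) → ι
  measurableSet_select : ∀ n i,
    MeasurableSet {q : R × (Fin (n + 1) → ∀ j, X j) | select n q.1 q.2 = i}
  select_holds : ∀ n r (h : Fin (n + 1) → ∀ j, X j),
    (∃ i, h (Fin.last n) ∈ S.event i) → h (Fin.last n) ∈ S.event (select n r h)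

open Classical in
/-- Resampling the event `i`: the variables in `vbl i` receive the fresh values `fresh`, all other
variables keep their current value. -/
noncomputable def resample (S : VarSystem ι X) (i : ι) (fresh cur : ∀ j, X j) : ∀ j, X j :=
  fun j => if j ∈ S.vbl i then fresh j else cur j

open Classical in
/-- The assignments at times `0, …, n` of the Moser-Tardos algorithm run with the seed `r`. The
initial assignment is `ξ 0`; while some event holds, the selected event is resampled, the fresh
values in step `n + 1` being read from the vector `ξ (n + 1)` (of which only the coordinates in
`vbl` of the selected event are used). Once no event holds, the assignment is frozen. -/
noncomputable def history {R : Type*} [MeasurableSpace R] (S : VarSystem ι X)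
    (rule : S.SelectionRule R) (r : R) (ξ : ℕ → ∀ j, X j) : (n : ℕ) → Fin (n + 1) → ∀ j, X j
  | 0 => fun _ => ξ 0
  | n + 1 =>
    let h := history S rule r ξ n
    Fin.snoc (α := fun _ => ∀ j, X j) h
      (if ∃ i, h (Fin.last n) ∈ S.event i then
        S.resample (rule.select n r h) (ξ (n + 1)) (h (Fin.last n))
      else h (Fin.last n))

/-- The number `T` of resampling steps (infinite if the algorithm never stops): there is one such
step for each time `n` at which some event holds under the current assignment. -/
noncomputable def numSteps {R : Type*} [MeasurableSpace R] (S : VarSystem ι X)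
    (rule : S.SelectionRule R) (r : R) (ξ : ℕ → ∀ j, X j) : ℕ∞ :=
  {n : ℕ | ∃ i, S.history rule r ξ n (Fin.last n) ∈ S.event i}.encard

/-- The law of the fresh samples: independent copies, over all times, of the joint law. -/
noncomputable def sampleLaw (S : VarSystem ι X) : Measure (ℕ → ∀ j, X j) :=
  Measure.infinitePi fun _ : ℕ => S.law

/-- The expected number of resampling steps, for a seed of law `ρ` that is independent of the
samples. -/
noncomputable def expectedSteps {R : Type*} [MeasurableSpace R] (S : VarSystem ι X)
    (rule : S.SelectionRule R) (ρ : Measure R) : ℝ≥0∞ :=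
  ∫⁻ ω, (S.numSteps rule ω.1 ω.2 : ℝ≥0∞) ∂(ρ.prod S.sampleLaw)

end VarSystem

/-- A relation is acyclic if it has no directed cycle (in particular no loop). -/
def IsAcyclicRel {V : Type*} (r : V → V → Prop) : Prop := ∀ v, ¬ Relation.TransGen r v v

/-- A (finite) witness DAG of the graph `G`, on the node set `Fin size`. -/
structure Wdag {ι : Type*} (G : SimpleGraph ι) where
  size : ℕ
  label : Fin size → ι
  arc : Fin size → Fin size → Prop
  acyclic : IsAcyclicRel arc
  arc_iff : ∀ u v, u ≠ v →
    ((arc u v ∨ arc v u) ↔ (label u = label v ∨ G.Adj (label u) (label v)))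

namespace Wdag

variable {ι : Type*} {G : SimpleGraph ι}

/-- A witness DAG is proper if it has exactly one sink. -/
def IsProper (D : Wdag G) : Prop := ∃! w, ∀ v, ¬ D.arc w v

/-- `e` is an isomorphism of labelled digraphs. -/
def IsIso (D D' : Wdag G) (e : Fin D.size ≃ Fin D'.size) : Prop :=
  (∀ v, D'.label (e v) = D.label v) ∧ ∀ u v, D'.arc (e u) (e v) ↔ D.arc u v

/-- The arc relation after the arc `u → v` has been replaced by `v → u`. -/
def reversedArc (D : Wdag G) (u v : Fin D.size) : Fin D.size → Fin D.size → Prop :=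
  fun a b => (D.arc a b ∧ ¬ (a = u ∧ b = v)) ∨ (a = v ∧ b = u)

/-- `u → v` is an arc whose reversal leaves the digraph acyclic. -/
def Reversible (D : Wdag G) (u v : Fin D.size) : Prop :=
  D.arc u v ∧ IsAcyclicRel (D.reversedArc u v)

/-- `u → v` is a reversible arc whose end labels form an edge of `M`. -/
def MReversible (M : G.Subgraph) (D : Wdag G) (u v : Fin D.size) : Prop :=
  D.Reversible u v ∧ M.Adj (D.label u) (D.label v)

open Classical in
/-- The set of nodes that lie on some `M`-reversible arc. -/
noncomputable def revNodes (M : G.Subgraph) (D : Wdag G) : Finset (Fin D.size) :=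
  {v | ∃ u, D.MReversible M u v ∨ D.MReversible M v u}

open Classical in
/-- The product of `p` over the nodes outside `revNodes` times the product of `p'` over the nodes
in `revNodes`. -/
noncomputable def weight (M : G.Subgraph) (p p' : ι → ℝ) (D : Wdag G) : ℝ :=
  (∏ v ∈ (D.revNodes M)ᶜ, p (D.label v)) * ∏ v ∈ D.revNodes M, p' (D.label v)

theorem IsIso.refl (D : Wdag G) : IsIso D D (Equiv.refl _) :=
  ⟨fun _ => rfl, fun _ _ => Iff.rfl⟩

theorem IsIso.symm {D D' : Wdag G} {e : Fin D.size ≃ Fin D'.size} (h : IsIso D D' e) :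
    IsIso D' D e.symm :=
  ⟨fun v => by simpa using (h.1 (e.symm v)).symm,
    fun u v => by simpa using (h.2 (e.symm u) (e.symm v)).symm⟩

theorem IsIso.trans {D D' D'' : Wdag G} {e : Fin D.size ≃ Fin D'.size}
    {f : Fin D'.size ≃ Fin D''.size} (h : IsIso D D' e) (k : IsIso D' D'' f) :
    IsIso D D'' (e.trans f) :=
  ⟨fun v => by simp [k.1, h.1], fun u v => by simp [k.2, h.2]⟩

theorem IsIso.reversible {D D' : Wdag G} {e : Fin D.size ≃ Fin D'.size} (h : IsIso D D' e)
    {u v : Fin D.size} (huv : D.Reversible u v) : D'.Reversible (e u) (e v) := by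
  refine ⟨(h.2 u v).2 huv.1, fun w hw => huv.2 (e.symm w) ?_⟩
  refine Relation.TransGen.lift (p := D.reversedArc u v) e.symm ?_ _ _ hw
  rintro a b (⟨hab, hne⟩ | ⟨rfl, rfl⟩)
  · refine Or.inl ⟨by simpa using (h.2 (e.symm a) (e.symm b)).1 (by simpa using hab), ?_⟩
    rintro ⟨rfl, rfl⟩
    exact hne ⟨by simp, by simp⟩
  · exact Or.inr ⟨by simp, by simp⟩

theorem IsIso.mReversible {D D' : Wdag G} {e : Fin D.size ≃ Fin D'.size} (h : IsIso D D' e)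
    (M : G.Subgraph) {u v : Fin D.size} (huv : D.MReversible M u v) :
    D'.MReversible M (e u) (e v) :=
  ⟨h.reversible huv.1, by rw [h.1, h.1]; exact huv.2⟩

theorem IsIso.mem_revNodes {D D' : Wdag G} {e : Fin D.size ≃ Fin D'.size} (h : IsIso D D' e)
    (M : G.Subgraph) (v : Fin D.size) : e v ∈ D'.revNodes M ↔ v ∈ D.revNodes M := by
  simp only [revNodes, Finset.mem_filter, Finset.mem_univ, true_and]
  constructor
  · rintro ⟨u, hu⟩
    refine ⟨e.symm u, hu.imp (fun k => ?_) (fun k => ?_)⟩ <;>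
      simpa using h.symm.mReversible M k
  · rintro ⟨u, hu⟩
    exact ⟨e u, hu.imp (fun k => h.mReversible M k) (fun k => h.mReversible M k)⟩

theorem IsIso.weight_eq {D D' : Wdag G} {e : Fin D.size ≃ Fin D'.size} (h : IsIso D D' e)
    (M : G.Subgraph) (p p' : ι → ℝ) : D.weight M p p' = D'.weight M p p' := by
  unfold weight
  congr 1
  · refine Finset.prod_equiv e (fun v => ?_) (fun v _ => by rw [h.1])
    simp [h.mem_revNodes]
  · refine Finset.prod_equiv e (fun v => ?_) (fun v _ => by rw [h.1])
    simp [h.mem_revNodes]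

/-- Isomorphism of proper witness DAGs. -/
instance properSetoid (G : SimpleGraph ι) : Setoid {D : Wdag G // D.IsProper} where
  r D D' := ∃ e, IsIso D.1 D'.1 e
  iseqv := ⟨fun D => ⟨_, IsIso.refl D.1⟩, fun ⟨_, h⟩ => ⟨_, h.symm⟩,
    fun ⟨_, h⟩ ⟨_, k⟩ => ⟨_, h.trans k⟩⟩

end Wdag

/-- The set of proper witness DAGs of `G`, up to isomorphism. -/
def PWdag {ι : Type*} (G : SimpleGraph ι) : Type _ := Quotient (Wdag.properSetoid G)

/-- The weight of a proper witness DAG (it does not depend on the representative). -/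
noncomputable def PWdag.weight {ι : Type*} {G : SimpleGraph ι} (M : G.Subgraph) (p p' : ι → ℝ)
    (D : PWdag G) : ℝ :=
  Quotient.lift (s := Wdag.properSetoid G) (fun D => D.1.weight M p p')
    (fun _ _ ⟨_, h⟩ => h.weight_eq M p p') D

/-!
The idea is to compare a run of the algorithm with a *resampling table*, which contains, for each
variable `j`, an infinite column of independent samples of `j`; the `k`-th sample of `j` drawn by
the algorithm is the entry `(k, j)`. The samples of a run, completed by independent ones, have the
law of such a table (`VarSystem.lintegral_runTable`). The resampling step at time `m` has a witness
DAG, formed by the earlier steps on which it depends. This DAG is consistent with the table: the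
node `v` reads the variable `j` from the row given by the number of predecessors of `v` that
resample `j`, and the event of `v` holds for the values which are read. Since different nodes read
different entries, this yields the classical bound by the sum of the products of the `p (L v)`.

The improvement comes from the fact that the reversal of an arc `u → v` may preserve consistency,
namely if the events of `u` and `v` still hold after `u` and `v` have exchanged the values of their
common variables (`Swappable`); of the two orders only one is realised by a run. To count only one
of them, toss a fair coin for every pair of nodes (nodes being named by label and rank), which
prescribes the direction of the arc between them. Call a DAG *good* if it is consistent and every
swappable `M`-reversible arc has the prescribed direction. Starting from any consistent DAG, reverse
swappable arcs with the wrong direction, each time keeping only the ancestors of the sink; the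
number of arcs with the wrong direction decreases, so that this ends in a good DAG whose sink has
the same name (`VarSystem.exists_good`). The steps of a run have distinct names, hence for every table and
all coins the number of steps is at most the number of good proper DAGs
(`VarSystem.card_le_tsum_good`).

It remains to bound the probability that a given DAG is good. Let `F` be a maximal set of pairwise
node-disjoint `M`-reversible arcs. The blocks formed by the arcs in `F` and the other nodes read
disjoint parts of the table, so their contributions are independent. An arc with end labels `i`
and `i'` contributes at most `p i * p i' - P(swappable) / 2 ≤ p i * p i' - δ² / 2`, where the lower
bound `δ²` is the Cauchy-Schwarz inequality (`VarSystem.sq_le_lintegral_swappable`). By maximality,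
each arc in `F` accounts for at most four nodes on `M`-reversible arcs
(`Wdag.IsPacking.prod_pow_four_le`), and `1 - y / 2 ≤ (1 - y / 8) ^ 4` with
`y = δ² / (p i * p i')` gives the weight in the theorem.
-/

/-! ### Product measures -/

section ProductMeasure

variable {I : Type*} {Y : I → Type*} [∀ i, MeasurableSpace (Y i)]

theorem measurable_piecewise_pi (P : Set I) [DecidablePred (· ∈ P)] :
    Measurable fun q : (∀ i, Y i) × (∀ i, Y i) => P.piecewise q.1 q.2 := by
  refine measurable_pi_lambda _ fun i => ?_
  by_cases h : i ∈ P
  · simp only [Set.piecewise, h, if_true]; fun_prop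
  · simp only [Set.piecewise, h, if_false]; fun_prop

/-- Gluing two independent samples of a product measure along a set of coordinates gives a sample
of the same product measure. All uses of independence below go through this fact. -/
theorem measurePreserving_piecewise (ν : ∀ i, Measure (Y i)) [∀ i, IsProbabilityMeasure (ν i)]
    (P : Set I) [DecidablePred (· ∈ P)] :
    MeasurePreserving (fun q : (∀ i, Y i) × (∀ i, Y i) => P.piecewise q.1 q.2)
      ((Measure.infinitePi ν).prod (Measure.infinitePi ν)) (Measure.infinitePi ν) := by
  refine ⟨measurable_piecewise_pi P, Measure.eq_infinitePi _ fun s t ht => ?_⟩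
  rw [Measure.map_apply (measurable_piecewise_pi P)
    (MeasurableSet.pi s.countable_toSet fun i _ => ht i)]
  have : (fun q : (∀ i, Y i) × (∀ i, Y i) => P.piecewise q.1 q.2) ⁻¹' (Set.pi s t) =
      (Set.pi (s.filter (· ∈ P)) t) ×ˢ (Set.pi (s.filter (· ∉ P)) t) := by
    ext q
    simp only [Set.mem_preimage, Set.mem_pi, Set.mem_prod, Finset.coe_filter, Set.mem_ofPred_eq,
      Finset.mem_coe]
    constructor
    · intro h
      exact ⟨fun i hi => by simpa [Set.piecewise, hi.2] using h i hi.1,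
        fun i hi => by simpa [Set.piecewise, hi.2] using h i hi.1⟩
    · rintro ⟨h1, h2⟩ i hi
      by_cases hP : i ∈ P
      · simpa [Set.piecewise, hP] using h1 i ⟨hi, hP⟩
      · simpa [Set.piecewise, hP] using h2 i ⟨hi, hP⟩
  rw [this, Measure.prod_prod, Measure.infinitePi_pi, Measure.infinitePi_pi,
    Finset.prod_filter_mul_prod_filter_not]
  · exact fun i _ => ht i
  · exact fun i _ => ht i

theorem lintegral_infinitePi_piecewise (ν : ∀ i, Measure (Y i)) [∀ i, IsProbabilityMeasure (ν i)]
    (P : Set I) [DecidablePred (· ∈ P)] {f : (∀ i, Y i) → ℝ≥0∞} (hf : Measurable f) :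
    ∫⁻ y, f y ∂(Measure.infinitePi ν) =
      ∫⁻ y, ∫⁻ z, f (P.piecewise y z) ∂(Measure.infinitePi ν) ∂(Measure.infinitePi ν) := by
  rw [← (measurePreserving_piecewise ν P).lintegral_comp hf]
  exact lintegral_prod _ (hf.comp (measurable_piecewise_pi P)).aemeasurable

/-- Functions of disjoint sets of coordinates are independent. -/
theorem lintegral_mul_of_dependsOn (ν : ∀ i, Measure (Y i)) [∀ i, IsProbabilityMeasure (ν i)]
    {P Q : Set I} (hPQ : Disjoint P Q) {f g : (∀ i, Y i) → ℝ≥0∞} (hf : Measurable f)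
    (hg : Measurable g) (hfP : DependsOn f P) (hgQ : DependsOn g Q) :
    ∫⁻ y, f y * g y ∂(Measure.infinitePi ν) =
      (∫⁻ y, f y ∂(Measure.infinitePi ν)) * ∫⁻ y, g y ∂(Measure.infinitePi ν) := by
  classical
  rw [lintegral_infinitePi_piecewise ν P (f := fun y => f y * g y) (hf.mul hg)]
  have h : ∀ y z, f (P.piecewise y z) * g (P.piecewise y z) = f y * g z := fun y z => by
    congr 1
    · exact hfP fun i hi => by simp [Set.piecewise, hi]
    · exact hgQ fun i hi => by simp [Set.piecewise, Set.disjoint_right.1 hPQ hi]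
  simp_rw [h]
  simp_rw [lintegral_const_mul _ hg]
  rw [lintegral_mul_const _ hf]

omit [∀ i, MeasurableSpace (Y i)] in
theorem DependsOn.finset_prod {B : Type*} {f : B → (∀ i, Y i) → ℝ≥0∞} {P : B → Set I}
    (h : ∀ b, DependsOn (f b) (P b)) (s : Finset B) :
    DependsOn (fun y => ∏ b ∈ s, f b y) (⋃ b ∈ s, P b) := fun _ _ hyz =>
  Finset.prod_congr rfl fun b hb => h b fun i hi => hyz i (Set.mem_biUnion hb hi)

theorem lintegral_prod_of_dependsOn (ν : ∀ i, Measure (Y i)) [∀ i, IsProbabilityMeasure (ν i)]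
    {B : Type*} (s : Finset B) {f : B → (∀ i, Y i) → ℝ≥0∞} {P : B → Set I}
    (hf : ∀ b, Measurable (f b)) (h : ∀ b, DependsOn (f b) (P b))
    (hP : ∀ b ∈ s, ∀ b' ∈ s, b ≠ b' → Disjoint (P b) (P b')) :
    ∫⁻ y, ∏ b ∈ s, f b y ∂(Measure.infinitePi ν) =
      ∏ b ∈ s, ∫⁻ y, f b y ∂(Measure.infinitePi ν) := by
  classical
  induction s using Finset.induction_on with
  | empty => simp
  | insert a s ha ih =>
    simp_rw [Finset.prod_insert ha]
    rw [lintegral_mul_of_dependsOn ν (Q := ⋃ b ∈ s, P b) _ (hf a)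
      (Finset.measurable_fun_prod s fun b _ => hf b) (h a) (DependsOn.finset_prod h s), ih]
    · exact fun b hb b' hb' => hP b (Finset.mem_insert_of_mem hb) b' (Finset.mem_insert_of_mem hb')
    · rw [Set.disjoint_iUnion₂_right]
      exact fun b hb => hP a (Finset.mem_insert_self a s) b (Finset.mem_insert_of_mem hb)
        (fun hab => ha (hab ▸ hb))

end ProductMeasure

/-! ### Resampling tables -/

namespace VarSystem

variable {ι : Type*} {κ : Type*} [Fintype κ] {X : κ → Type*} [∀ j, MeasurableSpace (X j)]

/-- The law of a resampling table: for each variable `j` an infinite column of independent samples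
of law `μ j`, the entry in row `k` being the coordinate `(k, j)`. -/
noncomputable def tableLaw (S : VarSystem ι X) : Measure (∀ p : ℕ × κ, X p.2) :=
  Measure.infinitePi fun p : ℕ × κ => S.μ p.2

instance (S : VarSystem ι X) : IsProbabilityMeasure S.tableLaw := by
  unfold tableLaw; infer_instance

instance (S : VarSystem ι X) : IsProbabilityMeasure S.sampleLaw := by
  unfold sampleLaw; infer_instance

/-- The assignment that takes the value of the variable `j` from row `q j` of a table. -/
def tableRow (q : κ → ℕ) (τ : ∀ p : ℕ × κ, X p.2) : ∀ j, X j := fun j => τ (q j, j)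

omit [Fintype κ] [∀ j, MeasurableSpace (X j)] in
theorem tableRow_congr {q q' : κ → ℕ} {τ : ∀ p : ℕ × κ, X p.2} {j : κ} (h : q j = q' j) :
    tableRow q τ j = tableRow q' τ j := by
  rw [tableRow, tableRow, h]

omit [Fintype κ] in
theorem measurable_tableRow (q : κ → ℕ) : Measurable (tableRow (X := X) q) :=
  measurable_pi_lambda _ fun j => measurable_pi_apply (q j, j)

theorem measurePreserving_tableRow (S : VarSystem ι X) (q : κ → ℕ) :
    MeasurePreserving (tableRow (X := X) q) S.tableLaw S.law := by
  classical
  refine ⟨measurable_tableRow q, ?_⟩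
  rw [law, ← Measure.infinitePi_eq_pi]
  refine Measure.eq_infinitePi _ fun s t ht => ?_
  rw [Measure.map_apply (measurable_tableRow q)
    (MeasurableSet.pi s.countable_toSet fun i _ => ht i)]
  have : tableRow (X := X) q ⁻¹' (Set.pi s t) =
      Set.pi (s.image fun j => (q j, j)) fun p : ℕ × κ => t p.2 := by
    ext τ
    simp [tableRow, Set.mem_pi]
  rw [this, tableLaw, Measure.infinitePi_pi, Finset.prod_image]
  · exact fun a _ b _ hab => (Prod.ext_iff.1 hab).2
  · exact fun p _ => ht p.2

/-- Rows of a table read at disjoint sets of positions are independent. -/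
theorem lintegral_tableRow_tableRow (S : VarSystem ι X) {q q' : κ → ℕ} (hq : ∀ j, q j ≠ q' j)
    {f : (∀ j, X j) × (∀ j, X j) → ℝ≥0∞} (hf : Measurable f) :
    ∫⁻ τ, f (tableRow q τ, tableRow q' τ) ∂S.tableLaw =
      ∫⁻ x, ∫⁻ y, f (x, y) ∂S.law ∂S.law := by
  classical
  have hm : Measurable fun τ : ∀ p : ℕ × κ, X p.2 => f (tableRow q τ, tableRow q' τ) :=
    hf.comp ((measurable_tableRow q).prodMk (measurable_tableRow q'))
  rw [tableLaw, lintegral_infinitePi_piecewise _ {p : ℕ × κ | p.1 = q p.2} hm, ← tableLaw]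
  have h : ∀ y z : ∀ p : ℕ × κ, X p.2,
      f (tableRow q (Set.piecewise {p : ℕ × κ | p.1 = q p.2} y z),
        tableRow q' (Set.piecewise {p : ℕ × κ | p.1 = q p.2} y z)) =
      f (tableRow q y, tableRow q' z) := fun y z => by
    congr 2
    · funext j; simp [tableRow, Set.piecewise]
    · funext j; simp [tableRow, Set.piecewise, (hq j).symm]
  simp_rw [h]
  rw [← (S.measurePreserving_tableRow q).lintegral_comp (Measurable.lintegral_prod_right' hf)]
  refine lintegral_congr fun y => ?_
  exact (S.measurePreserving_tableRow q').lintegral_comp (hf.comp measurable_prodMk_left)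

open Classical in
/-- The table `τ` after its entries `(p j, j)` with `j ∈ A` have been replaced by `x j`. -/
noncomputable def writeRow (A : Set κ) (p : κ → ℕ) (x : ∀ j, X j) (τ : ∀ p : ℕ × κ, X p.2) :
    ∀ p : ℕ × κ, X p.2 :=
  fun a => if a.2 ∈ A ∧ a.1 = p a.2 then x a.2 else τ a

omit [Fintype κ] in
theorem measurable_writeRow (A : Set κ) (p : κ → ℕ) :
    Measurable fun q : (∀ j, X j) × (∀ p : ℕ × κ, X p.2) => writeRow A p q.1 q.2 := by
  refine measurable_pi_lambda _ fun a => ?_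
  by_cases h : a.2 ∈ A ∧ a.1 = p a.2
  · simp only [writeRow, h, and_self, if_true]; fun_prop
  · simp only [writeRow, h, if_false]; fun_prop

/-- Overwriting entries of a table by fresh samples does not change its law. -/
theorem lintegral_writeRow (S : VarSystem ι X) (A : Set κ) (p : κ → ℕ)
    {g : (∀ p : ℕ × κ, X p.2) → ℝ≥0∞} (hg : Measurable g) :
    ∫⁻ x, ∫⁻ τ, g (writeRow A p x τ) ∂S.tableLaw ∂S.law = ∫⁻ τ, g τ ∂S.tableLaw := by
  classical
  conv_rhs => rw [tableLaw, lintegral_infinitePi_piecewise _ {a : ℕ × κ | a.2 ∈ A ∧ a.1 = p a.2} hg,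
    ← tableLaw]
  have hm : Measurable fun x => ∫⁻ τ, g (writeRow A p x τ) ∂S.tableLaw :=
    Measurable.lintegral_prod_right' (hg.comp (measurable_writeRow A p))
  rw [← (S.measurePreserving_tableRow p).lintegral_comp hm]
  refine lintegral_congr fun y => lintegral_congr fun z => ?_
  congr 1
  funext a
  by_cases h : a.2 ∈ A ∧ a.1 = p a.2
  · obtain ⟨k, j⟩ := a
    obtain ⟨h1, h2⟩ := h
    simp only at h1 h2
    subst h2
    simp [writeRow, tableRow, Set.piecewise, h1]
  · simp [writeRow, Set.piecewise, h]

/-- Resampling the coordinates in `A` leaves `E` with probability at least `P(E)²`: conditionally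
on the coordinates outside `A`, the two samples are independent and identically distributed, so
that this is the Cauchy-Schwarz inequality. -/
theorem sq_le_lintegral_piecewise (S : VarSystem ι X) (A : Set κ) [DecidablePred (· ∈ A)]
    {E : Set (∀ j, X j)} (hE : MeasurableSet E) :
    S.law E ^ 2 ≤
      ∫⁻ x, ∫⁻ y, E.indicator 1 x * E.indicator 1 (A.piecewise y x) ∂S.law ∂S.law := by
  have hlaw : S.law = Measure.infinitePi S.μ := by rw [law, Measure.infinitePi_eq_pi]
  have hi : Measurable (E.indicator (1 : (∀ j, X j) → ℝ≥0∞)) := measurable_one.indicator hE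
  have hpw := measurable_piecewise_pi (Y := X) A
  have hF : Measurable fun q : (∀ j, X j) × (∀ j, X j) =>
      E.indicator (1 : (∀ j, X j) → ℝ≥0∞) (A.piecewise q.1 q.2) := hi.comp hpw
  -- `h w` is the conditional probability of `E` given the coordinates of `w` outside `A`
  set h : (∀ j, X j) → ℝ≥0∞ := fun w => ∫⁻ z, E.indicator 1 (A.piecewise z w) ∂S.law with hh
  have hmeas : Measurable h := Measurable.lintegral_prod_left' hF
  have h1 : S.law E = ∫⁻ w, h w ∂S.law := by
    rw [← lintegral_indicator_one hE, hh, lintegral_lintegral_swap]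
    · conv_lhs => rw [hlaw, lintegral_infinitePi_piecewise S.μ A hi, ← hlaw]
    · exact (hF.comp measurable_swap).aemeasurable
  have hG : Measurable fun x => ∫⁻ y, E.indicator (1 : (∀ j, X j) → ℝ≥0∞) x *
      E.indicator 1 (A.piecewise y x) ∂S.law := by
    refine Measurable.lintegral_prod_right' (f := fun q : (∀ j, X j) × (∀ j, X j) =>
      E.indicator (1 : (∀ j, X j) → ℝ≥0∞) q.1 * E.indicator 1 (A.piecewise q.2 q.1)) ?_
    exact (hi.comp measurable_fst).mul (hF.comp measurable_swap)
  have h2 : ∫⁻ x, ∫⁻ y, E.indicator 1 x * E.indicator 1 (A.piecewise y x) ∂S.law ∂S.law =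
      ∫⁻ w, h w ^ 2 ∂S.law := by
    have hP (z w y : ∀ j, X j) : A.piecewise y (A.piecewise z w) = A.piecewise y w := by
      funext j; by_cases hj : j ∈ A <;> simp [Set.piecewise, hj]
    conv_lhs => rw [hlaw, lintegral_infinitePi_piecewise S.μ A (hlaw ▸ hG), ← hlaw]
    rw [lintegral_lintegral_swap]
    · refine lintegral_congr fun w => ?_
      simp_rw [hP]
      have (z : ∀ j, X j) : ∫⁻ y, E.indicator 1 (A.piecewise z w) *
          E.indicator 1 (A.piecewise y w) ∂S.law = E.indicator 1 (A.piecewise z w) * h w := by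
        rw [lintegral_const_mul]
        exact hF.comp measurable_prodMk_right
      simp_rw [this]
      rw [lintegral_mul_const, sq]
      exact hF.comp measurable_prodMk_right
    · exact (hG.comp hpw).aemeasurable
  rw [h1, h2]
  have := ENNReal.lintegral_mul_le_Lp_mul_Lq S.law Real.HolderConjugate.two_two
    hmeas.aemeasurable (aemeasurable_const (b := (1 : ℝ≥0∞)))
  simp only [Pi.mul_apply, mul_one, one_pow, ENNReal.one_rpow, lintegral_one, measure_univ,
    ENNReal.rpow_ofNat] at this
  calc (∫⁻ w, h w ∂S.law) ^ 2 ≤ ((∫⁻ w, h w ^ 2 ∂S.law) ^ (1 / 2 : ℝ)) ^ 2 := by gcongr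
    _ = _ := by rw [← ENNReal.rpow_natCast, ← ENNReal.rpow_mul]; norm_num

end VarSystem

/-! ### Witness DAGs -/

namespace Wdag

variable {ι : Type*} {G : SimpleGraph ι}

theorem arc_irrefl (D : Wdag G) (a : Fin D.size) : ¬ D.arc a a := fun h =>
  D.acyclic a (.single h)

theorem arc_asymm (D : Wdag G) {a b : Fin D.size} (h : D.arc a b) : ¬ D.arc b a := fun h' =>
  D.acyclic a (.tail (.single h) h')

theorem arc_no_triangle (D : Wdag G) {a b c : Fin D.size} (h : D.arc a b) (h' : D.arc b c) :
    ¬ D.arc c a := fun h'' => D.acyclic a (.tail (.tail (.single h) h') h'')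

theorem arc_ne (D : Wdag G) {a b : Fin D.size} (h : D.arc a b) : a ≠ b := fun hab =>
  D.arc_irrefl a (by rwa [← hab] at h)

theorem arc_of_arc_of_arc (D : Wdag G) {a b c : Fin D.size} (h : D.arc a b) (h' : D.arc b c)
    (hac : D.label a = D.label c ∨ G.Adj (D.label a) (D.label c)) : D.arc a c := by
  refine ((D.arc_iff a c ?_).2 hac).resolve_right (D.arc_no_triangle h h')
  rintro rfl
  exact D.arc_asymm h h'

theorem ncard_pred_lt (D : Wdag G) {P : ι → Prop}
    (hP : ∀ i i', P i → P i' → i = i' ∨ G.Adj i i') {u v : Fin D.size} (hu : P (D.label u))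
    (hv : P (D.label v)) (huv : D.arc u v) :
    {y | P (D.label y) ∧ D.arc y u}.ncard < {y | P (D.label y) ∧ D.arc y v}.ncard := by
  refine Set.ncard_lt_ncard ⟨fun y hy => ⟨hy.1, D.arc_of_arc_of_arc hy.2 huv (hP _ _ hy.1 hv)⟩,
    fun h => D.arc_irrefl u (h ⟨hu, huv⟩).2⟩ (Set.toFinite _)

/-- The number of predecessors with the same label. Nodes with equal labels are linearly ordered
by the arcs, and the rank is the position in this order. -/
noncomputable def rank (D : Wdag G) (v : Fin D.size) : ℕ :=
  {y | D.label y = D.label v ∧ D.arc y v}.ncard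

/-- The name of a node: its label together with its rank. Distinct nodes have distinct names, and
names do not depend on the choice of a representative in an isomorphism class. -/
noncomputable def name (D : Wdag G) (v : Fin D.size) : ι × ℕ := (D.label v, D.rank v)

theorem name_injective (D : Wdag G) : Function.Injective D.name := by
  intro u v h
  by_contra hne
  have hl : D.label u = D.label v := congrArg Prod.fst h
  have hr : D.rank u = D.rank v := congrArg Prod.snd h
  have key (a b : Fin D.size) (hab : D.label a = D.label b) (h : D.arc a b) :
      D.rank a < D.rank b := by
    have := D.ncard_pred_lt (P := (· = D.label b))
      (fun i i' hi hi' => Or.inl (hi.trans hi'.symm)) hab rfl h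
    simpa [rank, hab] using this
  rcases (D.arc_iff u v hne).2 (Or.inl hl) with h | h
  · exact (key u v hl h).ne hr
  · exact (key v u hl.symm h).ne' hr

/-- `f` embeds `D'` into `D` as a set of nodes that is closed under predecessors. -/
structure IsPrefix (D' D : Wdag G) (f : Fin D'.size → Fin D.size) : Prop where
  injective : Function.Injective f
  label_eq : ∀ v, D.label (f v) = D'.label v
  arc_iff : ∀ u v, D.arc (f u) (f v) ↔ D'.arc u v
  mem_range : ∀ u v, D.arc u (f v) → u ∈ Set.range f

theorem IsIso.isPrefix {D D' : Wdag G} {e : Fin D.size ≃ Fin D'.size} (h : IsIso D D' e) :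
    IsPrefix D D' e :=
  ⟨e.injective, h.1, h.2, fun u _ _ => e.surjective u⟩

theorem IsPrefix.ncard_pred {D' D : Wdag G} {f : Fin D'.size → Fin D.size} (hf : IsPrefix D' D f)
    (P : ι → Prop) (v : Fin D'.size) :
    {y | P (D.label y) ∧ D.arc y (f v)}.ncard = {y | P (D'.label y) ∧ D'.arc y v}.ncard := by
  rw [← Set.ncard_image_of_injective _ hf.injective]
  congr 1
  ext y
  constructor
  · rintro ⟨hy, hyv⟩
    obtain ⟨x, rfl⟩ := hf.mem_range y v hyv
    exact ⟨x, ⟨hf.label_eq x ▸ hy, (hf.arc_iff x v).1 hyv⟩, rfl⟩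
  · rintro ⟨x, ⟨hx, hxv⟩, rfl⟩
    exact ⟨(hf.label_eq x).symm ▸ hx, (hf.arc_iff x v).2 hxv⟩

theorem IsPrefix.name_eq {D' D : Wdag G} {f : Fin D'.size → Fin D.size} (hf : IsPrefix D' D f)
    (v : Fin D'.size) : D.name (f v) = D'.name v := by
  simp only [name, rank, hf.label_eq]
  rw [hf.ncard_pred (· = D'.label v)]

/-- The witness DAG induced on the nodes from which `w` can be reached. -/
noncomputable def ancestors (D : Wdag G) (w : Fin D.size) : Wdag G :=
  let e : {x // Relation.ReflTransGen D.arc x w} ≃ Fin (Nat.card _) := Finite.equivFin _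
  { size := Nat.card {x // Relation.ReflTransGen D.arc x w}
    label := fun a => D.label (e.symm a).1
    arc := fun a b => D.arc (e.symm a).1 (e.symm b).1
    acyclic := fun a h => D.acyclic (e.symm a).1
      (Relation.TransGen.lift (fun x => (e.symm x).1) (fun _ _ => id) _ _ h)
    arc_iff := fun _ _ hab => D.arc_iff _ _ fun h => hab (e.symm.injective (Subtype.ext h)) }

theorem exists_isPrefix_ancestors (D : Wdag G) (w : Fin D.size) :
    ∃ f w', IsPrefix (D.ancestors w) D f ∧ f w' = w ∧ (∀ v, ¬ (D.ancestors w).arc w' v) ∧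
      (D.ancestors w).IsProper := by
  let e : {x // Relation.ReflTransGen D.arc x w} ≃ Fin (Nat.card _) := Finite.equivFin _
  have hs : ∀ v, ¬ (D.ancestors w).arc (e ⟨w, .refl⟩) v := fun v hv => by
    have h1 : D.arc w (e.symm v).1 := by
      simpa [ancestors, e] using hv
    exact D.acyclic w (.head' h1 (e.symm v).2)
  refine ⟨fun a => (e.symm a).1, e ⟨w, .refl⟩, ⟨fun a b hab => e.symm.injective (Subtype.ext hab),
    fun _ => rfl, fun _ _ => Iff.rfl, fun u v huv => ?_⟩, by simp, hs, e ⟨w, .refl⟩, hs, ?_⟩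
  · exact ⟨e ⟨u, .head huv (e.symm v).2⟩, by simp⟩
  · intro y hy
    by_contra hne
    rcases Relation.ReflTransGen.cases_head (e.symm y).2 with h | ⟨z, hz, hzw⟩
    · refine hne ?_
      rw [← e.apply_symm_apply y]
      congr 1
      exact Subtype.ext h
    · refine hy (e ⟨z, hzw⟩) ?_
      change D.arc (e.symm y).1 (e.symm (e ⟨z, hzw⟩)).1
      simpa using hz

/-- The witness DAG in which a reversible arc has been reversed. -/
def flip (D : Wdag G) {u v : Fin D.size} (h : D.Reversible u v) : Wdag G where
  size := D.size
  label := D.label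
  arc := D.reversedArc u v
  acyclic := h.2
  arc_iff a b hab := by
    rw [← D.arc_iff a b hab]
    have := h.1
    unfold reversedArc
    constructor
    · rintro ((⟨h, -⟩ | ⟨rfl, rfl⟩) | (⟨h, -⟩ | ⟨rfl, rfl⟩)) <;> tauto
    · tauto

theorem flip_arc_iff (D : Wdag G) {u v : Fin D.size} (h : D.Reversible u v) {a b : Fin D.size}
    (h1 : ¬ (a = u ∧ b = v)) (h2 : ¬ (a = v ∧ b = u)) : (D.flip h).arc a b ↔ D.arc a b := by
  simp only [flip, reversedArc]
  tauto

theorem flip_name (D : Wdag G) {u v : Fin D.size} (h : D.Reversible u v)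
    (hl : D.label u ≠ D.label v) (x : Fin D.size) : (D.flip h).name x = D.name x := by
  have : {y | D.label y = D.label x ∧ (D.flip h).arc y x} =
      {y | D.label y = D.label x ∧ D.arc y x} := by
    ext y
    refine and_congr_right fun hyx => D.flip_arc_iff h ?_ ?_
    · rintro ⟨rfl, rfl⟩; exact hl hyx
    · rintro ⟨rfl, rfl⟩; exact hl hyx.symm
  simp only [name, rank]
  exact congrArg (fun s => (D.label x, Set.ncard s)) this

/-- There is no path from `u` to `v` besides a reversible arc `u → v`; here the paths with two
arcs are excluded. -/
theorem Reversible.not_arc_arc {D : Wdag G} {u v : Fin D.size} (h : D.Reversible u v)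
    {y : Fin D.size} (hu : D.arc u y) : ¬ D.arc y v := fun hv => by
  have h1 : D.reversedArc u v u y := Or.inl ⟨hu, fun hh => D.arc_irrefl v (hh.2 ▸ hv)⟩
  have h2 : D.reversedArc u v y v := Or.inl ⟨hv, fun hh => D.arc_irrefl u (hh.1 ▸ hu)⟩
  have h3 : D.reversedArc u v v u := Or.inr ⟨rfl, rfl⟩
  exact h.2 u (.tail (.tail (.single h1) h2) h3)

/-- The ends of a reversible arc have the same predecessors among the nodes that are comparable to
both of them, apart from the ends themselves. -/
theorem Reversible.arc_iff_arc {D : Wdag G} {u v : Fin D.size} (h : D.Reversible u v)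
    {y : Fin D.size} (hyu : D.label y = D.label u ∨ G.Adj (D.label y) (D.label u))
    (hyv : D.label y = D.label v ∨ G.Adj (D.label y) (D.label v)) :
    (D.arc y v ∧ y ≠ u) ↔ D.arc y u := by
  constructor
  · rintro ⟨hy, hne⟩
    exact ((D.arc_iff y u hne).2 hyu).resolve_right fun hh => h.not_arc_arc hh hy
  · intro hy
    exact ⟨D.arc_of_arc_of_arc hy h.1 hyv, D.arc_ne hy⟩

end Wdag

/-! ### Consistency with a resampling table -/

namespace VarSystem

variable {ι : Type*} {κ : Type*} [Fintype κ] {X : κ → Type*} [∀ j, MeasurableSpace (X j)]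
variable (S : VarSystem ι X)

theorem depGraph_of_mem {i i' : ι} {j : κ} (h : j ∈ S.vbl i) (h' : j ∈ S.vbl i') :
    i = i' ∨ S.depGraph.Adj i i' := by
  by_cases hii : i = i'
  · exact Or.inl hii
  · exact Or.inr ⟨hii, j, h, h'⟩

/-- The row of the resampling table from which the node `v` reads the variable `j`: the number of
predecessors of `v` that resample `j`. (It is only of interest when the label of `v` depends
on `j`.) -/
noncomputable def depth (D : Wdag S.depGraph) (v : Fin D.size) (j : κ) : ℕ :=
  {y | j ∈ S.vbl (D.label y) ∧ D.arc y v}.ncard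

theorem depth_lt_depth (D : Wdag S.depGraph) {u v : Fin D.size} {j : κ}
    (hu : j ∈ S.vbl (D.label u)) (hv : j ∈ S.vbl (D.label v)) (huv : D.arc u v) :
    S.depth D u j < S.depth D v j :=
  D.ncard_pred_lt (P := fun i => j ∈ S.vbl i) (fun _ _ h h' => S.depGraph_of_mem h h') hu hv huv

theorem depth_injective (D : Wdag S.depGraph) {u v : Fin D.size} {j : κ}
    (hu : j ∈ S.vbl (D.label u)) (hv : j ∈ S.vbl (D.label v))
    (h : S.depth D u j = S.depth D v j) : u = v := by
  by_contra hne
  rcases (D.arc_iff u v hne).2 (S.depGraph_of_mem hu hv) with h' | h'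
  · exact (S.depth_lt_depth D hu hv h').ne h
  · exact (S.depth_lt_depth D hv hu h').ne' h

theorem depth_eq_of_isPrefix {D' D : Wdag S.depGraph} {f : Fin D'.size → Fin D.size}
    (hf : D'.IsPrefix D f) (v : Fin D'.size) : S.depth D (f v) = S.depth D' v :=
  funext fun j => hf.ncard_pred (fun i => j ∈ S.vbl i) v

/-- For a variable shared by the ends of a reversible arc `u → v`, the node `v` reads the row
following the one read by `u`. -/
theorem depth_of_reversible {D : Wdag S.depGraph} {u v : Fin D.size} (h : D.Reversible u v)
    {j : κ} (hu : j ∈ S.vbl (D.label u)) (hv : j ∈ S.vbl (D.label v)) :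
    S.depth D v j = S.depth D u j + 1 := by
  have hset : {y | j ∈ S.vbl (D.label y) ∧ D.arc y v} =
      insert u {y | j ∈ S.vbl (D.label y) ∧ D.arc y u} := by
    ext y
    by_cases hyu : y = u
    · subst hyu; simpa [hu] using h.1
    · simp only [Set.mem_ofPred_eq, Set.mem_insert_iff, hyu, false_or]
      refine and_congr_right fun hy => ?_
      rw [← h.arc_iff_arc (S.depGraph_of_mem hy hu) (S.depGraph_of_mem hy hv)]
      simp [hyu]
  rw [depth, depth, hset, Set.ncard_insert_of_notMem (fun hh => D.arc_irrefl u hh.2)]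

theorem depth_flip_of_ne {D : Wdag S.depGraph} {u v : Fin D.size} (h : D.Reversible u v)
    {x : Fin D.size} (hu : x ≠ u) (hv : x ≠ v) : S.depth (D.flip h) x = S.depth D x := by
  funext j
  refine congrArg Set.ncard (Set.ext fun y => and_congr_right fun _ => D.flip_arc_iff h ?_ ?_)
  · exact fun hh => hv hh.2
  · exact fun hh => hu hh.2

/-- After the reversal of an arc `u → v`, its two ends have exchanged the entries which they read
for their common variables. -/
theorem depth_flip_right {D : Wdag S.depGraph} {u v : Fin D.size} (h : D.Reversible u v)
    {j : κ} (hv : j ∈ S.vbl (D.label v)) [Decidable (j ∈ S.vbl (D.label u))] :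
    S.depth (D.flip h) v j =
      if j ∈ S.vbl (D.label u) then S.depth D u j else S.depth D v j := by
  have hvu : v ≠ u := (D.arc_ne h.1).symm
  split_ifs with hu
  · refine congrArg Set.ncard (Set.ext fun y => and_congr_right fun hy => ?_)
    rw [← h.arc_iff_arc (S.depGraph_of_mem hy hu) (S.depGraph_of_mem hy hv)]
    simp [Wdag.flip, Wdag.reversedArc, hvu]
  · refine congrArg Set.ncard (Set.ext fun y => and_congr_right fun hy => D.flip_arc_iff h ?_ ?_)
    · exact fun hh => hu (hh.1 ▸ hy)
    · exact fun hh => hvu hh.2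

theorem depth_flip_left {D : Wdag S.depGraph} {u v : Fin D.size} (h : D.Reversible u v)
    {j : κ} (hu : j ∈ S.vbl (D.label u)) [Decidable (j ∈ S.vbl (D.label v))] :
    S.depth (D.flip h) u j =
      if j ∈ S.vbl (D.label v) then S.depth D v j else S.depth D u j := by
  have huv : u ≠ v := D.arc_ne h.1
  split_ifs with hv
  · rw [S.depth_of_reversible h hu hv]
    have hset : {y | j ∈ S.vbl (D.label y) ∧ (D.flip h).arc y u} =
        insert v {y | j ∈ S.vbl (D.label y) ∧ D.arc y u} := by
      ext y
      by_cases hyv : y = v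
      · subst hyv; simp [hv, Wdag.flip, Wdag.reversedArc]
      · simp [hyv, Wdag.flip, Wdag.reversedArc, huv]
    exact (congrArg Set.ncard hset).trans
      (Set.ncard_insert_of_notMem fun hh => D.arc_asymm h.1 hh.2)
  · refine congrArg Set.ncard (Set.ext fun y => and_congr_right fun hy => D.flip_arc_iff h ?_ ?_)
    · exact fun hh => huv hh.2
    · exact fun hh => hv (hh.1 ▸ hy)

/-- A witness DAG is consistent with a resampling table if the event of each node holds for the
values which the node reads from the table. -/
def Consistent (D : Wdag S.depGraph) (τ : ∀ p : ℕ × κ, X p.2) : Prop :=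
  ∀ v, tableRow (S.depth D v) τ ∈ S.event (D.label v)

open Classical in
/-- The events of the nodes `u` and `v` still hold after `u` and `v` have exchanged the values of
their common variables. -/
def Swappable (D : Wdag S.depGraph) (τ : ∀ p : ℕ × κ, X p.2) (u v : Fin D.size) : Prop :=
  (S.vbl (D.label u)).piecewise (tableRow (S.depth D u) τ) (tableRow (S.depth D v) τ) ∈
      S.event (D.label v) ∧
    (S.vbl (D.label v)).piecewise (tableRow (S.depth D v) τ) (tableRow (S.depth D u) τ) ∈
      S.event (D.label u)

theorem Consistent.of_isPrefix {D' D : Wdag S.depGraph} {f : Fin D'.size → Fin D.size}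
    (hf : D'.IsPrefix D f) {τ : ∀ p : ℕ × κ, X p.2} (h : S.Consistent D τ) :
    S.Consistent D' τ := fun v => by
  rw [← S.depth_eq_of_isPrefix hf, ← hf.label_eq]
  exact h (f v)

theorem Consistent.flip {D : Wdag S.depGraph} {u v : Fin D.size} (h : D.Reversible u v)
    {τ : ∀ p : ℕ × κ, X p.2} (hD : S.Consistent D τ) (hs : S.Swappable D τ u v) :
    S.Consistent (D.flip h) τ := by
  classical
  intro (x : Fin D.size)
  change tableRow (S.depth (D.flip h) x) τ ∈ S.event (D.label x)
  by_cases hxv : x = v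
  · rw [hxv]
    refine (S.event_congr _ _ _ fun j hj => ?_).1 hs.1
    rw [tableRow, S.depth_flip_right h hj]
    by_cases hu : j ∈ S.vbl (D.label u)
    · rw [if_pos hu]; simp [hu, tableRow]
    · rw [if_neg hu]; simp [hu, tableRow]
  · by_cases hxu : x = u
    · rw [hxu]
      refine (S.event_congr _ _ _ fun j hj => ?_).1 hs.2
      rw [tableRow, S.depth_flip_left h hj]
      by_cases hv : j ∈ S.vbl (D.label v)
      · rw [if_pos hv]; simp [hv, tableRow]
      · rw [if_neg hv]; simp [hv, tableRow]
    · rw [S.depth_flip_of_ne h hxu hxv]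
      exact hD x

theorem swappable_iff_of_isPrefix {D' D : Wdag S.depGraph} {f : Fin D'.size → Fin D.size}
    (hf : D'.IsPrefix D f) {τ : ∀ p : ℕ × κ, X p.2} (u v : Fin D'.size) :
    S.Swappable D τ (f u) (f v) ↔ S.Swappable D' τ u v := by
  rw [Swappable, S.depth_eq_of_isPrefix hf, S.depth_eq_of_isPrefix hf, hf.label_eq, hf.label_eq]
  rfl

end VarSystem

/-! ### Breaking ties by coins -/

open Classical in
/-- The arc from the node named `a` to the node named `b` agrees with the coins `c`: the coin of
the pair `{a, b}` says which of the two labels comes first in a fixed well-order. -/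
def CoinAgrees {ι : Type*} (c : Sym2 (ι × ℕ) → Bool) (a b : ι × ℕ) : Prop :=
  c s(a, b) = decide (WellOrderingRel a.1 b.1)

theorem CoinAgrees.or_swap {ι : Type*} (c : Sym2 (ι × ℕ) → Bool) {a b : ι × ℕ} (h : a.1 ≠ b.1) :
    CoinAgrees c a b ∨ CoinAgrees c b a := by
  unfold CoinAgrees
  rw [Sym2.eq_swap (a := b)]
  rcases trichotomous_of WellOrderingRel a.1 b.1 with h' | h' | h'
  · have : ¬ WellOrderingRel b.1 a.1 := asymm_of _ h'
    simp [h', this]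
  · exact absurd h' h
  · have : ¬ WellOrderingRel a.1 b.1 := asymm_of _ h'
    simp [h', this]

namespace PWdag

variable {ι : Type*} {G : SimpleGraph ι}

/-- A representative of an isomorphism class of proper witness DAGs. -/
noncomputable def rep (Q : PWdag G) : Wdag G :=
  (Quotient.out (s := Wdag.properSetoid G) Q).1

theorem rep_isProper (Q : PWdag G) : Q.rep.IsProper :=
  (Quotient.out (s := Wdag.properSetoid G) Q).2

theorem weight_eq_rep (Q : PWdag G) (M : G.Subgraph) (p p' : ι → ℝ) :
    Q.weight M p p' = Q.rep.weight M p p' := by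
  conv_lhs => rw [← Quotient.out_eq (s := Wdag.properSetoid G) Q]
  rfl

/-- The name of the sink of a proper witness DAG. -/
noncomputable def sinkName (Q : PWdag G) : ι × ℕ := Q.rep.name Q.rep_isProper.choose

theorem sinkName_eq (Q : PWdag G) {w : Fin Q.rep.size} (hw : ∀ v, ¬ Q.rep.arc w v) :
    Q.sinkName = Q.rep.name w := by
  rw [sinkName, Q.rep_isProper.unique Q.rep_isProper.choose_spec.1 hw]

theorem exists_isIso_rep {D : Wdag G} (hD : D.IsProper) :
    ∃ (Q : PWdag G) (e : Fin D.size ≃ Fin Q.rep.size), D.IsIso Q.rep e := by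
  obtain ⟨e, he⟩ := Quotient.mk_out (s := Wdag.properSetoid G) ⟨D, hD⟩
  exact ⟨Quotient.mk (Wdag.properSetoid G) ⟨D, hD⟩, e.symm, he.symm⟩

instance [Finite ι] : Countable (PWdag G) := by
  have : Countable (Wdag G) := by
    let f : Wdag G → Σ n : ℕ, (Fin n → ι) × (Fin n → Fin n → Prop) :=
      fun D => ⟨D.size, D.label, D.arc⟩
    have hf : Function.Injective f := by
      rintro ⟨n, l, r, h1, h2⟩ ⟨n', l', r', h1', h2'⟩ h
      obtain ⟨rfl, h⟩ := Sigma.mk.inj_iff.1 h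
      obtain ⟨rfl, rfl⟩ := Prod.mk.injEq .. ▸ eq_of_heq h
      rfl
    exact hf.countable
  unfold PWdag
  infer_instance

end PWdag

namespace VarSystem

variable {ι : Type*} {κ : Type*} [Fintype κ] {X : κ → Type*} [∀ j, MeasurableSpace (X j)]
variable (S : VarSystem ι X) (M : S.depGraph.Subgraph)

/-- A consistent witness DAG in which the coins agree with the direction of every arc that could
be reversed without loss of consistency. -/
def Good (D : Wdag S.depGraph) (τ : ∀ p : ℕ × κ, X p.2) (c : Sym2 (ι × ℕ) → Bool) : Prop :=
  S.Consistent D τ ∧ ∀ u v, D.MReversible M u v → S.Swappable D τ u v →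
    CoinAgrees c (D.name u) (D.name v)

theorem Good.of_isIso {D D' : Wdag S.depGraph} {e : Fin D.size ≃ Fin D'.size}
    (h : D.IsIso D' e) {τ : ∀ p : ℕ × κ, X p.2} {c : Sym2 (ι × ℕ) → Bool}
    (hD : S.Good M D τ c) : S.Good M D' τ c := by
  have hp := h.symm.isPrefix
  refine ⟨Consistent.of_isPrefix S hp hD.1, fun u v huv hs => ?_⟩
  rw [← hp.name_eq, ← hp.name_eq]
  exact hD.2 _ _ (h.symm.mReversible M huv) ((S.swappable_iff_of_isPrefix hp u v).2 hs)

/-- The arcs with labels in `M` that disagree with the coins. -/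
def disagreeing (D : Wdag S.depGraph) (c : Sym2 (ι × ℕ) → Bool) : Set (Fin D.size × Fin D.size) :=
  {q | D.arc q.1 q.2 ∧ M.Adj (D.label q.1) (D.label q.2) ∧
    ¬ CoinAgrees c (D.name q.1) (D.name q.2)}

theorem ncard_disagreeing_le_of_isPrefix {D' D : Wdag S.depGraph}
    {f : Fin D'.size → Fin D.size} (hf : D'.IsPrefix D f) (c : Sym2 (ι × ℕ) → Bool) :
    (S.disagreeing M D' c).ncard ≤ (S.disagreeing M D c).ncard := by
  refine Set.ncard_le_ncard_of_injOn (Prod.map f f) ?_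
    (hf.injective.prodMap hf.injective).injOn (Set.toFinite _)
  rintro ⟨a, b⟩ ⟨h1, h2, h3⟩
  refine ⟨(hf.arc_iff a b).2 h1, ?_, ?_⟩
  · simpa [hf.label_eq] using h2
  · simpa [hf.name_eq] using h3

theorem ncard_disagreeing_flip_lt {D : Wdag S.depGraph} {u v : Fin D.size}
    (h : D.Reversible u v) (hM : M.Adj (D.label u) (D.label v)) {c : Sym2 (ι × ℕ) → Bool}
    (hc : ¬ CoinAgrees c (D.name u) (D.name v)) :
    (S.disagreeing M (D.flip h) c).ncard < (S.disagreeing M D c).ncard := by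
  have hl : D.label u ≠ D.label v := (M.adj_sub hM).ne
  have hsub : ∀ q : Fin D.size × Fin D.size, q ∈ S.disagreeing M (D.flip h) c →
      q ∈ S.disagreeing M D c \ {(u, v)} := by
    rintro ⟨a, b⟩ ⟨h1, h2, h3⟩
    simp only [D.flip_name h hl] at h3
    rcases h1 with ⟨h1, hne⟩ | ⟨ha, hb⟩
    · exact ⟨⟨h1, h2, h3⟩, fun hq => hne (Prod.ext_iff.1 hq)⟩
    · simp only at ha hb
      rw [ha, hb] at h3
      exact absurd ((CoinAgrees.or_swap c hl).resolve_left hc) h3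
  refine (Set.ncard_le_ncard (t := S.disagreeing M D c \ {(u, v)}) hsub
    (Set.toFinite _)).trans_lt ?_
  exact Set.ncard_sdiff_singleton_lt_of_mem ⟨h.1, hM, hc⟩ (Set.toFinite _)

/-- If a consistent witness DAG has a node `w`, then some good proper witness DAG has a sink with
the same name: as long as there is a reversible arc that disagrees with the coins and whose
reversal preserves consistency, reverse it and keep only the ancestors of `w`. -/
theorem exists_good {τ : ∀ p : ℕ × κ, X p.2} (c : Sym2 (ι × ℕ) → Bool) (D : Wdag S.depGraph)
    (hD : S.Consistent D τ) (w : Fin D.size) :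
    ∃ Q : PWdag S.depGraph, S.Good M Q.rep τ c ∧ Q.sinkName = D.name w := by
  induction hn : (S.disagreeing M D c).ncard using Nat.strong_induction_on generalizing D with
  | _ n ih =>
    obtain ⟨f, w', hf, hfw, hw', hprop⟩ := D.exists_isPrefix_ancestors w
    have hle := S.ncard_disagreeing_le_of_isPrefix M hf c
    have hcons := Consistent.of_isPrefix S hf hD
    have hname : D.name w = (D.ancestors w).name w' :=
      (congrArg D.name hfw).symm.trans (hf.name_eq w')
    rw [hname]
    clear hname hfw hf
    generalize D.ancestors w = D' at *
    by_cases hgood : S.Good M D' τ c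
    · obtain ⟨Q, e, he⟩ := PWdag.exists_isIso_rep hprop
      refine ⟨Q, Good.of_isIso S M he hgood, ?_⟩
      rw [Q.sinkName_eq (w := e w'), he.isPrefix.name_eq]
      intro v hv
      refine hw' (e.symm v) ((he.2 _ _).1 ?_)
      simpa using hv
    · have : ∃ u v, D'.MReversible M u v ∧ S.Swappable D' τ u v ∧
          ¬ CoinAgrees c (D'.name u) (D'.name v) := by
        by_contra! hh
        exact hgood ⟨hcons, hh⟩
      obtain ⟨u, v, ⟨hrev, hM⟩, hs, hc⟩ := this
      obtain ⟨Q, hQ, hQw⟩ := ih _ (hn ▸ (S.ncard_disagreeing_flip_lt M hrev hM hc).trans_le hle)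
        (D'.flip hrev) (Consistent.flip S hrev hcons hs) w' rfl
      exact ⟨Q, hQ, hQw.trans (D'.flip_name hrev (M.adj_sub hM).ne w')⟩

/-- The witness DAG of a finite sequence of resampled events. -/
def logWdag (n : ℕ) (l : Fin n → ι) : Wdag S.depGraph where
  size := n
  label := l
  arc a b := a < b ∧ (l a = l b ∨ S.depGraph.Adj (l a) (l b))
  acyclic a h := by
    have : ∀ b, Relation.TransGen
        (fun a b => a < b ∧ (l a = l b ∨ S.depGraph.Adj (l a) (l b))) a b → a < b := fun b hb => by
      induction hb with
      | single h => exact h.1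
      | tail _ h ih => exact ih.trans h.1
    exact lt_irrefl a (this a h)
  arc_iff a b hab := by
    rcases lt_or_gt_of_ne hab with h | h
    · simp [h, h.not_gt]
    · simp [h, h.not_gt, eq_comm, S.depGraph.adj_comm]

open Classical in
/-- The number of times at which the variable `j` has been resampled before time `m`, if the event
`l m'` is resampled at each time `m'`. -/
noncomputable def logCount (l : ℕ → ι) (m : ℕ) (j : κ) : ℕ :=
  ((Finset.range m).filter fun m' => j ∈ S.vbl (l m')).card

open Classical in
/-- The name of the resampling step at time `m`: the event which is resampled, together with the
number of earlier resamplings of this event. -/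
noncomputable def logName (l : ℕ → ι) (m : ℕ) : ι × ℕ :=
  (l m, ((Finset.range m).filter fun m' => l m' = l m).card)

omit [Fintype κ] in
theorem logName_injective (l : ℕ → ι) : Function.Injective (logName l) := by
  classical
  intro a b h
  by_contra hne
  have hl : l a = l b := congrArg Prod.fst h
  have hc : ((Finset.range a).filter fun m' => l m' = l a).card =
    ((Finset.range b).filter fun m' => l m' = l b).card := congrArg Prod.snd h
  have key (a b : ℕ) (hab : a < b) (hl : l a = l b) :
      ((Finset.range a).filter fun m' => l m' = l a).card <
        ((Finset.range b).filter fun m' => l m' = l b).card := by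
    refine Finset.card_lt_card ((Finset.ssubset_iff_of_subset ?_).2 ⟨a, ?_, ?_⟩)
    · intro x hx
      simp only [Finset.mem_filter, Finset.mem_range] at hx ⊢
      exact ⟨hx.1.trans hab, hx.2.trans hl⟩
    · simpa using ⟨hab, hl⟩
    · simp
  rcases lt_or_gt_of_ne hne with h' | h'
  · exact (key a b h' hl).ne hc
  · exact (key b a h' hl.symm).ne' hc

theorem ncard_fin_pred {n : ℕ} (a : Fin n) (P : ℕ → Prop) [DecidablePred P] :
    {y : Fin n | P y ∧ y < a}.ncard = ((Finset.range a).filter P).card := by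
  rw [← Set.ncard_image_of_injective _ Fin.val_injective, ← Set.ncard_coe_finset]
  congr 1
  ext m
  simp only [Set.mem_image, Set.mem_ofPred_eq, Finset.coe_filter, Finset.mem_range]
  constructor
  · rintro ⟨y, ⟨hy, hya⟩, rfl⟩
    exact ⟨hya, hy⟩
  · rintro ⟨hm, hP⟩
    exact ⟨⟨m, hm.trans a.2⟩, ⟨hP, hm⟩, rfl⟩

theorem logWdag_name (l : ℕ → ι) {n : ℕ} (a : Fin n) :
    (S.logWdag n fun m => l m).name a = logName l a := by
  classical
  rw [logName, ← ncard_fin_pred a (fun m' => l m' = l a)]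
  refine Prod.ext rfl (congrArg Set.ncard (Set.ext fun y => and_congr_right fun hy => ?_))
  exact and_iff_left (Or.inl hy)

theorem logWdag_depth (l : ℕ → ι) {n : ℕ} (a : Fin n) {j : κ} (hj : j ∈ S.vbl (l a)) :
    S.depth (S.logWdag n fun m => l m) a j = S.logCount l a j := by
  classical
  rw [logCount, ← ncard_fin_pred a (fun m' => j ∈ S.vbl (l m'))]
  refine congrArg Set.ncard (Set.ext fun y => and_congr_right fun hy => ?_)
  exact and_iff_left (S.depGraph_of_mem hy hj)

/-- The number of resampling steps is at most the number of good proper witness DAGs, for every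
resampling table and every choice of the coins. -/
theorem card_le_tsum_good {τ : ∀ p : ℕ × κ, X p.2} (c : Sym2 (ι × ℕ) → Bool) (l : ℕ → ι) (n : ℕ)
    (h : ∀ m < n, tableRow (S.logCount l m) τ ∈ S.event (l m)) :
    (n : ℝ≥0∞) ≤ ∑' Q : PWdag S.depGraph, {c | S.Good M Q.rep τ c}.indicator 1 c := by
  classical
  have hcons : S.Consistent (S.logWdag n fun m => l m) τ := fun (a : Fin n) => by
    refine (S.event_congr _ _ _ fun j hj => ?_).1 (h a a.2)
    change τ (S.logCount l a j, j) = τ (S.depth (S.logWdag n fun m => l m) a j, j)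
    rw [S.logWdag_depth l a hj]
  have hex : ∀ a : Fin n, ∃ Q : PWdag S.depGraph, S.Good M Q.rep τ c ∧ Q.sinkName = logName l a :=
    fun a => S.logWdag_name l a ▸ S.exists_good M c _ hcons a
  choose Q hQ hname using hex
  have hinj : Function.Injective Q := fun a b hab => by
    have : logName l a = logName l b := by
      rw [← hname, ← hname, hab]
    exact Fin.ext (logName_injective l this)
  calc (n : ℝ≥0∞) = ∑ a : Fin n, {c | S.Good M (Q a).rep τ c}.indicator 1 c := by
        have (a : Fin n) : {c | S.Good M (Q a).rep τ c}.indicator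
            (1 : (Sym2 (ι × ℕ) → Bool) → ℝ≥0∞) c = 1 :=
          Set.indicator_of_mem (hQ a) 1
        simp [this]
    _ = ∑ q ∈ Finset.univ.image Q, {c | S.Good M q.rep τ c}.indicator 1 c := by
        rw [Finset.sum_image fun a _ b _ hab => hinj hab]
    _ ≤ _ := ENNReal.sum_le_tsum _

end VarSystem

/-! ### Packings of reversible arcs -/

namespace Wdag

variable {ι : Type*} {G : SimpleGraph ι} {M : G.Subgraph}

theorem MReversible.left_unique (hM : M.IsMatching) {D : Wdag G} {u u' v : Fin D.size}
    (h : D.MReversible M u v) (h' : D.MReversible M u' v) : u = u' := by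
  by_contra hne
  have hl : D.label u = D.label u' :=
    (hM (M.edge_vert h.2.symm)).unique h.2.symm h'.2.symm
  rcases (D.arc_iff u u' hne).2 (Or.inl hl) with h1 | h1
  · exact h.1.not_arc_arc h1 h'.1.1
  · exact h'.1.not_arc_arc h1 h.1.1

theorem MReversible.right_unique (hM : M.IsMatching) {D : Wdag G} {u v v' : Fin D.size}
    (h : D.MReversible M u v) (h' : D.MReversible M u v') : v = v' := by
  by_contra hne
  have hl : D.label v = D.label v' := (hM (M.edge_vert h.2)).unique h.2 h'.2
  rcases (D.arc_iff v v' hne).2 (Or.inl hl) with h1 | h1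
  · exact h'.1.not_arc_arc h.1.1 h1
  · exact h.1.not_arc_arc h'.1.1 h1

open Classical in
/-- The set of the end points of the arcs in `F`. -/
noncomputable def covered {n : ℕ} (F : Finset (Fin n × Fin n)) : Finset (Fin n) :=
  F.biUnion fun e => {e.1, e.2}

theorem mem_covered {n : ℕ} {F : Finset (Fin n × Fin n)} {v : Fin n} :
    v ∈ covered F ↔ ∃ e ∈ F, v = e.1 ∨ v = e.2 := by
  simp [covered]

/-- A set of pairwise node-disjoint `M`-reversible arcs. -/
structure IsPacking (M : G.Subgraph) (D : Wdag G) (F : Finset (Fin D.size × Fin D.size)) :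
    Prop where
  mReversible : ∀ e ∈ F, D.MReversible M e.1 e.2
  disjoint : ∀ e ∈ F, ∀ e' ∈ F, e ≠ e' →
    Disjoint ({e.1, e.2} : Finset (Fin D.size)) {e'.1, e'.2}

/-- A maximal packing meets every `M`-reversible arc. -/
theorem exists_isPacking (M : G.Subgraph) (D : Wdag G) :
    ∃ F, IsPacking M D F ∧
      ∀ u v, D.MReversible M u v → u ∈ covered F ∨ v ∈ covered F := by
  classical
  obtain ⟨F, hF, hmax⟩ := Finset.exists_max_image
    (Finset.univ.filter fun F => IsPacking M D F) Finset.card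
    ⟨∅, by simpa using ⟨by simp, by simp⟩⟩
  replace hF : IsPacking M D F := by simpa using hF
  refine ⟨F, hF, fun u v huv => ?_⟩
  by_contra! hcov
  have hnot : ∀ e ∈ F, Disjoint ({u, v} : Finset (Fin D.size)) {e.1, e.2} := by
    intro e he
    have h1 : u ≠ e.1 ∧ u ≠ e.2 := by simpa [mem_covered, he] using
      (fun h => hcov.1 (mem_covered.2 ⟨e, he, h⟩) : ¬ (u = e.1 ∨ u = e.2))
    have h2 : v ≠ e.1 ∧ v ≠ e.2 := by simpa [mem_covered, he] using
      (fun h => hcov.2 (mem_covered.2 ⟨e, he, h⟩) : ¬ (v = e.1 ∨ v = e.2))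
    simp [h1.1.symm, h1.2.symm, h2.1.symm, h2.2.symm]
  have hnm : (u, v) ∉ F := fun h => hcov.1 (mem_covered.2 ⟨_, h, Or.inl rfl⟩)
  have hins : IsPacking M D (insert (u, v) F) := by
    refine ⟨fun e he => ?_, fun e he e' he' hne => ?_⟩
    · rcases Finset.mem_insert.1 he with rfl | he
      · exact huv
      · exact hF.mReversible e he
    · rcases Finset.mem_insert.1 he with rfl | he <;>
        rcases Finset.mem_insert.1 he' with rfl | he'
      · exact absurd rfl hne
      · exact hnot e' he'
      · exact (hnot e he).symm
      · exact hF.disjoint e he e' he' hne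
  have := hmax _ (by simpa using hins)
  rw [Finset.card_insert_of_notMem hnm] at this
  omega

theorem IsPacking.prod_eq {D : Wdag G} {F : Finset (Fin D.size × Fin D.size)}
    (hF : IsPacking M D F) {N : Type*} [CommMonoid N] (g : Fin D.size → N) :
    ∏ v, g v = (∏ v ∈ (covered F)ᶜ, g v) * ∏ e ∈ F, g e.1 * g e.2 := by
  classical
  rw [← Finset.prod_compl_mul_prod (covered F), covered, Finset.prod_biUnion]
  · congr 1
    refine Finset.prod_congr rfl fun e he => ?_
    rw [Finset.prod_pair (D.arc_ne (hF.mReversible e he).1.1)]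
  · exact fun e he e' he' hne => hF.disjoint e he e' he' hne

theorem IsPacking.key_injOn {D : Wdag G} {F : Finset (Fin D.size × Fin D.size)}
    (hF : IsPacking M D F) :
    Set.InjOn (fun e : Fin D.size × Fin D.size => s(D.name e.1, D.name e.2)) F := by
  intro e he e' he' h
  by_contra hne
  have hd := hF.disjoint e he e' he' hne
  rcases Sym2.eq_iff.1 h with ⟨h1, -⟩ | ⟨h1, -⟩
  · simp [D.name_injective h1] at hd
  · simp [D.name_injective h1] at hd

end Wdag

/-! ### The law of the coins -/

/-- Independent fair coins, one for each pair of names of nodes. -/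
noncomputable def coinLaw (ι : Type*) : Measure (Sym2 (ι × ℕ) → Bool) :=
  Measure.infinitePi fun _ => (PMF.uniformOfFintype Bool).toMeasure

instance (ι : Type*) : IsProbabilityMeasure (coinLaw ι) := by
  unfold coinLaw; infer_instance

namespace VarSystem

variable {ι : Type*} {κ : Type*} [Fintype κ] {X : κ → Type*} [∀ j, MeasurableSpace (X j)]
variable (S : VarSystem ι X) {M : S.depGraph.Subgraph}

open Classical in
/-- Each swappable arc of a packing costs a factor `1 / 2` in the probability, over the coins, that
a witness DAG is good. -/
theorem coinLaw_good_le {D : Wdag S.depGraph} {F : Finset (Fin D.size × Fin D.size)}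
    (hF : D.IsPacking M F) (τ : ∀ p : ℕ × κ, X p.2) :
    coinLaw ι {c | S.Good M D τ c} ≤
      (∏ v, (S.event (D.label v)).indicator 1 (tableRow (S.depth D v) τ)) *
        ∏ e ∈ F, if S.Swappable D τ e.1 e.2 then 2⁻¹ else 1 := by
  by_cases hD : S.Consistent D τ
  · have h1 : ∏ v, (S.event (D.label v)).indicator (1 : (∀ j, X j) → ℝ≥0∞)
        (tableRow (S.depth D v) τ) = 1 :=
      Finset.prod_eq_one fun v _ => Set.indicator_of_mem (hD v) 1
    rw [h1, one_mul, ← Finset.prod_filter]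
    set F' := F.filter fun e => S.Swappable D τ e.1 e.2
    have hinj : Set.InjOn (fun e : Fin D.size × Fin D.size => s(D.name e.1, D.name e.2)) F' :=
      hF.key_injOn.mono (Finset.coe_subset.2 (Finset.filter_subset _ _))
    let t : Sym2 (ι × ℕ) → Set Bool := fun k => {b | ∀ e ∈ F', s(D.name e.1, D.name e.2) = k →
      b = decide (WellOrderingRel (D.name e.1).1 (D.name e.2).1)}
    have hsub : {c | S.Good M D τ c} ⊆
        Set.pi (F'.image fun e => s(D.name e.1, D.name e.2)) t := by
      intro c hc k _ e he hek
      obtain ⟨heF, hes⟩ := Finset.mem_filter.1 he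
      rw [← hek]
      exact hc.2 e.1 e.2 (hF.mReversible e heF) hes
    refine (measure_mono hsub).trans ?_
    rw [coinLaw, Measure.infinitePi_pi _ fun _ _ => MeasurableSet.of_discrete,
      Finset.prod_image hinj]
    refine Finset.prod_le_prod' fun e he => ?_
    calc _ ≤ (PMF.uniformOfFintype Bool).toMeasure
          {decide (WellOrderingRel (D.name e.1).1 (D.name e.2).1)} :=
          measure_mono fun b (hb : b ∈ t _) => hb e he rfl
      _ = 2⁻¹ := by
          rw [PMF.toMeasure_apply_singleton _ _ MeasurableSet.of_discrete]
          simp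
  · have : {c | S.Good M D τ c} = ∅ := Set.eq_empty_of_forall_notMem fun c hc => hD hc.1
    rw [this]
    simp

/-! ### Probabilities of blocks of nodes -/

/-- The entries of a resampling table which are read by the nodes in `N`. -/
def cells (D : Wdag S.depGraph) (N : Set (Fin D.size)) : Set (ℕ × κ) :=
  {p | ∃ v ∈ N, p.2 ∈ S.vbl (D.label v) ∧ p.1 = S.depth D v p.2}

theorem disjoint_cells (D : Wdag S.depGraph) {N N' : Set (Fin D.size)} (h : Disjoint N N') :
    Disjoint (S.cells D N) (S.cells D N') := by
  rw [Set.disjoint_left] at h ⊢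
  rintro p ⟨v, hv, hj, hp⟩ ⟨v', hv', hj', hp'⟩
  exact h hv (S.depth_injective D hj hj' (hp.symm.trans hp') ▸ hv')

/-- The indicator function of the event of the node `v`. -/
noncomputable def nodeInd (D : Wdag S.depGraph) (v : Fin D.size) (τ : ∀ p : ℕ × κ, X p.2) : ℝ≥0∞ :=
  (S.event (D.label v)).indicator 1 (tableRow (S.depth D v) τ)

theorem measurable_nodeInd (D : Wdag S.depGraph) (v : Fin D.size) :
    Measurable (S.nodeInd D v) :=
  (measurable_one.indicator (S.measurableSet_event _)).comp (measurable_tableRow _)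

theorem dependsOn_nodeInd (D : Wdag S.depGraph) {v : Fin D.size} {N : Set (Fin D.size)}
    (hv : v ∈ N) : DependsOn (S.nodeInd D v) (S.cells D N) := by
  intro τ τ' h
  have : tableRow (S.depth D v) τ ∈ S.event (D.label v) ↔
      tableRow (S.depth D v) τ' ∈ S.event (D.label v) :=
    S.event_congr _ _ _ fun j hj => h _ ⟨v, hv, hj, rfl⟩
  by_cases h0 : tableRow (S.depth D v) τ ∈ S.event (D.label v)
  · rw [nodeInd, nodeInd, Set.indicator_of_mem h0, Set.indicator_of_mem (this.1 h0)]
    rfl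
  · rw [nodeInd, nodeInd, Set.indicator_of_notMem h0, Set.indicator_of_notMem (mt this.2 h0)]

theorem lintegral_nodeInd (D : Wdag S.depGraph) (v : Fin D.size) :
    ∫⁻ τ, S.nodeInd D v τ ∂S.tableLaw = ENNReal.ofReal (S.prob (D.label v)) := by
  have hm : Measurable ((S.event (D.label v)).indicator (1 : (∀ j, X j) → ℝ≥0∞)) :=
    measurable_one.indicator (S.measurableSet_event _)
  unfold nodeInd
  rw [(S.measurePreserving_tableRow (S.depth D v)).lintegral_comp hm,
    lintegral_indicator_one (S.measurableSet_event _), prob, ofReal_measureReal]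

theorem measurableSet_swappable (D : Wdag S.depGraph) (u v : Fin D.size) :
    MeasurableSet {τ | S.Swappable D τ u v} := by
  classical
  have h (A : Set κ) [DecidablePred (· ∈ A)] (u v : Fin D.size) :
      Measurable fun τ : ∀ p : ℕ × κ, X p.2 =>
        A.piecewise (tableRow (S.depth D u) τ) (tableRow (S.depth D v) τ) :=
    (measurable_piecewise_pi A).comp ((measurable_tableRow _).prodMk (measurable_tableRow _))
  exact (h _ u v (S.measurableSet_event _)).inter (h _ v u (S.measurableSet_event _))

theorem measurableSet_good_prod (M : S.depGraph.Subgraph) (D : Wdag S.depGraph) :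
    MeasurableSet {q : (∀ p : ℕ × κ, X p.2) × (Sym2 (ι × ℕ) → Bool) | S.Good M D q.1 q.2} := by
  have h1 (v : Fin D.size) : MeasurableSet
      {q : (∀ p : ℕ × κ, X p.2) × (Sym2 (ι × ℕ) → Bool) |
        tableRow (S.depth D v) q.1 ∈ S.event (D.label v)} :=
    ((measurable_tableRow _).comp measurable_fst) (S.measurableSet_event _)
  have h2 (u v : Fin D.size) : MeasurableSet
      {q : (∀ p : ℕ × κ, X p.2) × (Sym2 (ι × ℕ) → Bool) | S.Swappable D q.1 u v} :=
    measurable_fst (S.measurableSet_swappable D u v)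
  have h3 (a b : ι × ℕ) : MeasurableSet
      {q : (∀ p : ℕ × κ, X p.2) × (Sym2 (ι × ℕ) → Bool) | CoinAgrees q.2 a b} :=
    measurable_snd (measurable_pi_apply s(a, b) (measurableSet_singleton _))
  exact MeasurableSet.inter
    (measurableSet_setOfPred.2 (.forall fun v => measurableSet_setOfPred.1 (h1 v)))
    (measurableSet_setOfPred.2 (.forall fun u => .forall fun v => .imp measurable_const
      (.imp (measurableSet_setOfPred.1 (h2 u v)) (measurableSet_setOfPred.1 (h3 _ _)))))

theorem measurableSet_good (M : S.depGraph.Subgraph) (D : Wdag S.depGraph)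
    (τ : ∀ p : ℕ × κ, X p.2) : MeasurableSet {c | S.Good M D τ c} :=
  measurable_prodMk_left (S.measurableSet_good_prod M D)

theorem swappable_congr (D : Wdag S.depGraph) {u v : Fin D.size} {τ τ' : ∀ p : ℕ × κ, X p.2}
    (h : ∀ p ∈ S.cells D {u, v}, τ p = τ' p) :
    S.Swappable D τ u v ↔ S.Swappable D τ' u v := by
  classical
  refine and_congr (S.event_congr _ _ _ fun j hj => ?_) (S.event_congr _ _ _ fun j hj => ?_)
  · by_cases hu : j ∈ S.vbl (D.label u)
    · simpa [hu, tableRow] using h (S.depth D u j, j) ⟨u, by simp, hu, rfl⟩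
    · simpa [hu, tableRow] using h (S.depth D v j, j) ⟨v, by simp, hj, rfl⟩
  · by_cases hv : j ∈ S.vbl (D.label v)
    · simpa [hv, tableRow] using h (S.depth D v j, j) ⟨v, by simp, hv, rfl⟩
    · simpa [hv, tableRow] using h (S.depth D u j, j) ⟨u, by simp, hj, rfl⟩

open Classical in
/-- The expected contribution, over the coins, of an arc of a packing. -/
noncomputable def arcFactor (D : Wdag S.depGraph) (e : Fin D.size × Fin D.size)
    (τ : ∀ p : ℕ × κ, X p.2) : ℝ≥0∞ :=
  S.nodeInd D e.1 τ * S.nodeInd D e.2 τ * if S.Swappable D τ e.1 e.2 then 2⁻¹ else 1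

theorem measurable_arcFactor (D : Wdag S.depGraph) (e : Fin D.size × Fin D.size) :
    Measurable (S.arcFactor D e) :=
  ((S.measurable_nodeInd D _).mul (S.measurable_nodeInd D _)).mul
    (Measurable.ite (S.measurableSet_swappable D _ _) measurable_const measurable_const)

theorem dependsOn_arcFactor (D : Wdag S.depGraph) (e : Fin D.size × Fin D.size) :
    DependsOn (S.arcFactor D e) (S.cells D {e.1, e.2}) := by
  intro τ τ' h
  classical
  have hs := S.swappable_congr D (u := e.1) (v := e.2) h
  rw [arcFactor, arcFactor, S.dependsOn_nodeInd D (v := e.1) (by simp) h,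
    S.dependsOn_nodeInd D (v := e.2) (by simp) h]
  congr 1
  exact if_congr hs rfl rfl

/-- The events of both ends of a reversible arc hold and are preserved by the exchange of the
common variables with probability at least `P(A ∩ B)²`. -/
theorem sq_le_lintegral_swappable {D : Wdag S.depGraph} {u v : Fin D.size}
    (h : D.Reversible u v) :
    S.law (S.event (D.label u) ∩ S.event (D.label v)) ^ 2 ≤
      ∫⁻ τ, S.nodeInd D u τ * S.nodeInd D v τ * {τ | S.Swappable D τ u v}.indicator 1 τ
        ∂S.tableLaw := by
  classical
  set A := S.vbl (D.label u)
  set B := S.vbl (D.label v)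
  set E := S.event (D.label u) ∩ S.event (D.label v)
  have hE : MeasurableSet E := (S.measurableSet_event _).inter (S.measurableSet_event _)
  have hi : Measurable (E.indicator (1 : (∀ j, X j) → ℝ≥0∞)) := measurable_one.indicator hE
  -- `q` points to the values before either event is resampled, and `q + 1`, on the common
  -- variables, to the values which are read by `v`
  let q : κ → ℕ := fun j => if j ∈ A then S.depth D u j else S.depth D v j
  refine (S.sq_le_lintegral_piecewise (A ∩ B) hE).trans ?_
  rw [← S.lintegral_tableRow_tableRow (q := q) (q' := fun j => q j + 1) (by simp)
    (f := fun z => E.indicator 1 z.1 * E.indicator 1 ((A ∩ B).piecewise z.2 z.1))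
    ((hi.comp measurable_fst).mul
      (hi.comp ((measurable_piecewise_pi _).comp measurable_swap)))]
  refine lintegral_mono fun τ => ?_
  by_cases h1 : tableRow q τ ∈ E
  swap
  · simp [h1]
  by_cases h2 : (A ∩ B).piecewise (tableRow (fun j => q j + 1) τ) (tableRow q τ) ∈ E
  swap
  · simp [h2]
  have hshift {j : κ} (hj : j ∈ A) (hj' : j ∈ B) : S.depth D u j + 1 = S.depth D v j :=
    (S.depth_of_reversible h hj hj').symm
  have hq {j : κ} (hj : j ∈ A) : tableRow q τ j = tableRow (S.depth D u) τ j :=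
    tableRow_congr (if_pos hj)
  have hq' {j : κ} (hj : j ∉ A) : tableRow q τ j = tableRow (S.depth D v) τ j :=
    tableRow_congr (if_neg hj)
  have hq1 {j : κ} (hj : j ∈ A) (hj' : j ∈ B) :
      tableRow (fun j => q j + 1) τ j = tableRow (S.depth D v) τ j :=
    tableRow_congr (by simp only [q, if_pos hj, hshift hj hj'])
  have hu : tableRow (S.depth D u) τ ∈ S.event (D.label u) :=
    (S.event_congr _ _ _ fun j (hj : j ∈ A) => hq hj).1 h1.1
  have hv : tableRow (S.depth D v) τ ∈ S.event (D.label v) := by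
    refine (S.event_congr _ _ _ fun j (hj : j ∈ B) => ?_).1 h2.2
    by_cases hA : j ∈ A
    · rw [Set.piecewise_eq_of_mem (A ∩ B) _ _ ⟨hA, hj⟩, hq1 hA hj]
    · rw [Set.piecewise_eq_of_notMem _ _ _ fun hh => hA hh.1, hq' hA]
  have hs : S.Swappable D τ u v := by
    constructor
    · refine (S.event_congr _ _ _ fun j (hj : j ∈ B) => ?_).1 h1.2
      by_cases hA : j ∈ A
      · rw [Set.piecewise_eq_of_mem _ _ _ hA, hq hA]
      · rw [Set.piecewise_eq_of_notMem _ _ _ hA, hq' hA]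
    · refine (S.event_congr _ _ _ fun j (hj : j ∈ A) => ?_).1 h2.1
      by_cases hB : j ∈ B
      · rw [Set.piecewise_eq_of_mem B _ _ hB,
          Set.piecewise_eq_of_mem (A ∩ B) _ _ ⟨hj, hB⟩, hq1 hj hB]
      · rw [Set.piecewise_eq_of_notMem B _ _ hB,
          Set.piecewise_eq_of_notMem _ _ _ fun hh => hB hh.2, hq hj]
  simp [nodeInd, h1, h2, hu, hv, hs]

theorem lintegral_arcFactor_le {D : Wdag S.depGraph} {e : Fin D.size × Fin D.size}
    (h : D.Reversible e.1 e.2) {d : ℝ} (hd0 : 0 ≤ d)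
    (hd : d ≤ S.law.real (S.event (D.label e.1) ∩ S.event (D.label e.2))) :
    ∫⁻ τ, S.arcFactor D e τ ∂S.tableLaw ≤
      ENNReal.ofReal (S.prob (D.label e.1) * S.prob (D.label e.2) - d ^ 2 / 2) := by
  classical
  obtain ⟨u, v⟩ := e
  set g : (∀ p : ℕ × κ, X p.2) → ℝ≥0∞ := fun τ =>
    S.nodeInd D u τ * S.nodeInd D v τ * {τ | S.Swappable D τ u v}.indicator 1 τ with hg
  have hgm : Measurable g := ((S.measurable_nodeInd D _).mul (S.measurable_nodeInd D _)).mul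
    (measurable_one.indicator (S.measurableSet_swappable D _ _))
  have hsum : ∫⁻ τ, S.arcFactor D (u, v) τ ∂S.tableLaw + 2⁻¹ * ∫⁻ τ, g τ ∂S.tableLaw =
      ENNReal.ofReal (S.prob (D.label u) * S.prob (D.label v)) := by
    rw [← lintegral_const_mul _ hgm, ← lintegral_add_left (S.measurable_arcFactor D _),
      ENNReal.ofReal_mul (p := S.prob (D.label u)) measureReal_nonneg,
      ← S.lintegral_nodeInd, ← S.lintegral_nodeInd]
    refine Eq.trans (lintegral_congr fun τ => ?_) (lintegral_mul_of_dependsOn _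
      (S.disjoint_cells D (Set.disjoint_singleton.2 (D.arc_ne h.1)))
      (S.measurable_nodeInd D u) (S.measurable_nodeInd D v)
      (S.dependsOn_nodeInd D rfl) (S.dependsOn_nodeInd D rfl))
    by_cases hs : S.Swappable D τ u v
    · simp only [arcFactor, hg, hs, if_true, Set.mem_ofPred_eq, Set.indicator_of_mem,
        Pi.one_apply, mul_one]
      rw [mul_comm (2⁻¹ : ℝ≥0∞), ← mul_add, ENNReal.inv_two_add_inv_two, mul_one]
    · simp [arcFactor, hg, hs]
  have hdg : ENNReal.ofReal (d ^ 2) ≤ ∫⁻ τ, g τ ∂S.tableLaw := by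
    refine le_trans ?_ (S.sq_le_lintegral_swappable h)
    rw [ENNReal.ofReal_pow hd0]
    gcongr
    exact ENNReal.ofReal_le_of_le_toReal hd
  rw [ENNReal.ofReal_sub _ (by positivity)]
  refine ENNReal.le_sub_of_add_le_right ENNReal.ofReal_ne_top ?_
  rw [← hsum]
  gcongr
  rw [div_eq_inv_mul, ENNReal.ofReal_mul (by norm_num), ENNReal.ofReal_inv_of_pos (by norm_num),
    ENNReal.ofReal_ofNat]
  gcongr

end VarSystem

/-! ### The weight of a witness DAG -/

namespace Wdag

variable {ι : Type*} {G : SimpleGraph ι} {M : G.Subgraph}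

/-- In a maximal packing `F` of `M`-reversible arcs, every arc `e` accounts for at most four nodes
on `M`-reversible arcs: its ends, the node before `e.1` and the node after `e.2`. -/
theorem IsPacking.prod_pow_four_le (hM : M.IsMatching) {D : Wdag G}
    {F : Finset (Fin D.size × Fin D.size)} (hF : IsPacking M D F)
    (hmax : ∀ u v, D.MReversible M u v → u ∈ covered F ∨ v ∈ covered F) {t : ι → ℝ}
    (ht0 : ∀ i i', M.Adj i i' → 0 ≤ t i) (ht1 : ∀ i i', M.Adj i i' → t i ≤ 1)
    (ht : ∀ i i', M.Adj i i' → t i = t i') :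
    ∏ e ∈ F, t (D.label e.1) ^ 4 ≤ ∏ v ∈ D.revNodes M, t (D.label v) := by
  classical
  have hex : ∀ v ∈ D.revNodes M, ∃ e ∈ F, t (D.label v) = t (D.label e.1) ∧
      (v = e.1 ∨ v = e.2 ∨ D.MReversible M v e.1 ∨ D.MReversible M e.2 v) := by
    have hcov : ∀ v ∈ covered F, ∃ e ∈ F, t (D.label v) = t (D.label e.1) ∧
        (v = e.1 ∨ v = e.2) := by
      intro v hv
      obtain ⟨e, he, h⟩ := mem_covered.1 hv
      refine ⟨e, he, ?_, h⟩
      rcases h with rfl | rfl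
      · rfl
      · exact (ht _ _ (hF.mReversible e he).2).symm
    intro v hv
    by_cases hvc : v ∈ covered F
    · obtain ⟨e, he, h, h'⟩ := hcov v hvc
      exact ⟨e, he, h, by tauto⟩
    · simp only [revNodes, Finset.mem_filter, Finset.mem_univ, true_and] at hv
      obtain ⟨u, hu⟩ := hv
      rcases hu with hu | hu
      · obtain ⟨e, he, h, h'⟩ := hcov u ((hmax _ _ hu).resolve_right hvc)
        refine ⟨e, he, (ht _ _ hu.2).symm.trans h, ?_⟩
        rcases h' with rfl | rfl
        · exact Or.inr (Or.inl (hu.right_unique hM (hF.mReversible e he)))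
        · exact Or.inr (Or.inr (Or.inr hu))
      · obtain ⟨e, he, h, h'⟩ := hcov u ((hmax _ _ hu).resolve_left hvc)
        refine ⟨e, he, (ht _ _ hu.2).trans h, ?_⟩
        rcases h' with rfl | rfl
        · exact Or.inr (Or.inr (Or.inl hu))
        · exact Or.inl (hu.left_unique hM (hF.mReversible e he))
  choose! φ hφF hφt hφ using hex
  rw [← Finset.prod_fiberwise_of_maps_to hφF]
  refine Finset.prod_le_prod (fun e he => pow_nonneg (ht0 _ _ (hF.mReversible e he).2) _)
    fun e he => ?_
  have h1 : ∏ v ∈ D.revNodes M with φ v = e, t (D.label v) =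
      t (D.label e.1) ^ (Finset.card {v ∈ D.revNodes M | φ v = e}) := by
    rw [← Finset.prod_const]
    refine Finset.prod_congr rfl fun v hv => ?_
    obtain ⟨hv', hve⟩ := Finset.mem_filter.1 hv
    exact hve ▸ hφt v hv'
  rw [h1]
  refine pow_le_pow_of_le_one (ht0 _ _ (hF.mReversible e he).2) (ht1 _ _ (hF.mReversible e he).2) ?_
  have hsub : ({v ∈ D.revNodes M | φ v = e} : Finset (Fin D.size)) ⊆
      (({e.1, e.2} : Finset (Fin D.size)) ∪
        Finset.univ.filter fun v => D.MReversible M v e.1) ∪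
        Finset.univ.filter fun v => D.MReversible M e.2 v := by
    intro v hv
    obtain ⟨hv', hve⟩ := Finset.mem_filter.1 hv
    have := hφ v hv'
    rw [hve] at this
    simp only [Finset.mem_union, Finset.mem_insert, Finset.mem_singleton, Finset.mem_filter,
      Finset.mem_univ, true_and]
    tauto
  have ha : (Finset.univ.filter fun v => D.MReversible M v e.1).card ≤ 1 :=
    Finset.card_le_one.2 fun a ha b hb =>
      (Finset.mem_filter.1 ha).2.left_unique hM (Finset.mem_filter.1 hb).2
  have hb : (Finset.univ.filter fun v => D.MReversible M e.2 v).card ≤ 1 :=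
    Finset.card_le_one.2 fun a ha b hb =>
      (Finset.mem_filter.1 ha).2.right_unique hM (Finset.mem_filter.1 hb).2
  calc _ ≤ _ := Finset.card_le_card hsub
    _ ≤ _ := Finset.card_union_le _ _
    _ ≤ (2 + 1) + 1 := by
      gcongr
      refine (Finset.card_union_le _ _).trans ?_
      gcongr
      exact Finset.card_le_two

end Wdag

namespace VarSystem

variable {ι : Type*} {κ : Type*} [Fintype κ] {X : κ → Type*} [∀ j, MeasurableSpace (X j)]
variable (S : VarSystem ι X) {M : S.depGraph.Subgraph} {δ : Sym2 ι → ℝ}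

theorem probReduced_eq (hM : M.IsMatching) {i i' : ι} (h : M.Adj i i') :
    S.probReduced M δ i = S.prob i - δ s(i, i') ^ 2 / (8 * S.prob i') := by
  have hex : ∃ i', M.Adj i i' := ⟨i', h⟩
  have : hex.choose = i' := (hM (M.edge_vert h)).unique hex.choose_spec h
  rw [probReduced, dif_pos hex, this]

/-- The bound `p p' - δ² / 2` for a pair of nodes is at most `p p' t⁴`, where
`t = 1 - δ² / (8 p p')` is the factor by which the probabilities of both events are reduced. -/
theorem pair_bound {p p' d : ℝ} (hd : 0 < d) (hp : d ≤ p) (hp' : d ≤ p') :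
    0 ≤ (p - d ^ 2 / (8 * p')) / p ∧ (p - d ^ 2 / (8 * p')) / p ≤ 1 ∧
      (p - d ^ 2 / (8 * p')) / p = (p' - d ^ 2 / (8 * p)) / p' ∧
      p * p' - d ^ 2 / 2 ≤ p * p' * ((p - d ^ 2 / (8 * p')) / p) ^ 4 := by
  have hp0 : 0 < p := hd.trans_le hp
  have hp0' : 0 < p' := hd.trans_le hp'
  set y := d ^ 2 / (p * p') with hy
  have hy0 : 0 ≤ y := by positivity
  have hy1 : y ≤ 1 := by
    rw [hy, div_le_one (by positivity), sq]
    exact mul_le_mul hp hp' hd.le hp0.le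
  have h1 : (p - d ^ 2 / (8 * p')) / p = 1 - y / 8 := by rw [hy]; field_simp
  have h2 : (p' - d ^ 2 / (8 * p)) / p' = 1 - y / 8 := by rw [hy]; field_simp
  rw [h1, h2]
  refine ⟨by linarith, by linarith, rfl, ?_⟩
  have h3 : p * p' - d ^ 2 / 2 = p * p' * (1 - y / 2) := by rw [hy]; field_simp
  rw [h3]
  gcongr
  have := one_add_mul_le_pow (a := -(y / 8)) (by linarith) 4
  push_cast at this
  rw [← sub_eq_add_neg] at this
  linarith

/-- The probability that a witness DAG is good is at most its weight. -/
theorem lintegral_coinLaw_good_le (hM : M.IsMatching)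
    (hδ : ∀ i i', M.Adj i i' → δ s(i, i') ∈ Set.Ioo (0 : ℝ) 1)
    (hδ_le : ∀ i i', M.Adj i i' → δ s(i, i') ≤ S.law.real (S.event i ∩ S.event i'))
    (D : Wdag S.depGraph) :
    ∫⁻ τ, coinLaw ι {c | S.Good M D τ c} ∂S.tableLaw ≤
      ENNReal.ofReal (D.weight M S.prob (S.probReduced M δ)) := by
  classical
  obtain ⟨F, hF, hmax⟩ := D.exists_isPacking M
  -- the factors of the blocks: the uncovered nodes and the arcs in `F`
  set f : Fin D.size ⊕ (Fin D.size × Fin D.size) → (∀ p : ℕ × κ, X p.2) → ℝ≥0∞ :=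
    Sum.elim (S.nodeInd D) (S.arcFactor D) with hf
  set N : Fin D.size ⊕ (Fin D.size × Fin D.size) → Finset (Fin D.size) :=
    Sum.elim (fun v => {v}) (fun e => {e.1, e.2}) with hN
  set s := (Wdag.covered F)ᶜ.disjSum F with hs
  have hδp {i i' : ι} (h : M.Adj i i') : δ s(i, i') ≤ S.prob i :=
    (hδ_le i i' h).trans (measureReal_mono Set.inter_subset_left)
  have hδp' {i i' : ι} (h : M.Adj i i') : δ s(i, i') ≤ S.prob i' :=
    (hδ_le i i' h).trans (measureReal_mono Set.inter_subset_right)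
  have hp0 (i : ι) : 0 ≤ S.prob i := measureReal_nonneg
  have h1 (τ : ∀ p : ℕ × κ, X p.2) : coinLaw ι {c | S.Good M D τ c} ≤ ∏ b ∈ s, f b τ := by
    refine (S.coinLaw_good_le hF τ).trans_eq ?_
    rw [hF.prod_eq, mul_assoc, ← Finset.prod_mul_distrib, hs, Finset.prod_disjSum]
    rfl
  have h2 : ∫⁻ τ, ∏ b ∈ s, f b τ ∂S.tableLaw = ∏ b ∈ s, ∫⁻ τ, f b τ ∂S.tableLaw := by
    refine lintegral_prod_of_dependsOn _ s (P := fun b => S.cells D (N b)) ?_ ?_ ?_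
    · rintro (v | e)
      · exact S.measurable_nodeInd D v
      · exact S.measurable_arcFactor D e
    · rintro (v | e)
      · exact S.dependsOn_nodeInd D (by simp [hN])
      · simpa [hN, hf] using S.dependsOn_arcFactor D e
    · intro b hb b' hb' hne
      refine S.disjoint_cells D (Finset.disjoint_coe.2 ?_)
      have key (v : Fin D.size) (hv : v ∈ (Wdag.covered F)ᶜ) (e : Fin D.size × Fin D.size)
          (he : e ∈ F) : Disjoint ({v} : Finset (Fin D.size)) {e.1, e.2} := by
        rw [Finset.disjoint_singleton_left]
        intro h
        exact Finset.mem_compl.1 hv (Wdag.mem_covered.2 ⟨e, he, by simpa using h⟩)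
      rcases b with v | e <;> rcases b' with v' | e' <;>
        simp only [hs, Finset.inl_mem_disjSum, Finset.inr_mem_disjSum] at hb hb'
      · simpa [hN, eq_comm] using hne
      · exact key v hb e' hb'
      · exact (key v' hb' e hb).symm
      · exact hF.disjoint e hb e' hb' fun h => hne (h ▸ rfl)
  -- the factor by which the probability of an event in the matching is reduced
  set t : ι → ℝ := fun i => S.probReduced M δ i / S.prob i with ht
  have hpair {i i' : ι} (h : M.Adj i i') : 0 ≤ t i ∧ t i ≤ 1 ∧ t i = t i' ∧
      S.prob i * S.prob i' - δ s(i, i') ^ 2 / 2 ≤ S.prob i * S.prob i' * t i ^ 4 := by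
    simp only [ht]
    rw [S.probReduced_eq hM h, S.probReduced_eq hM h.symm, Sym2.eq_swap (a := i')]
    exact pair_bound (hδ i i' h).1 (hδp h) (hδp' h)
  calc ∫⁻ τ, coinLaw ι {c | S.Good M D τ c} ∂S.tableLaw
      ≤ ∏ b ∈ s, ∫⁻ τ, f b τ ∂S.tableLaw := (lintegral_mono h1).trans_eq h2
    _ ≤ (∏ v ∈ (Wdag.covered F)ᶜ, ENNReal.ofReal (S.prob (D.label v))) *
        ∏ e ∈ F, ENNReal.ofReal (S.prob (D.label e.1) * S.prob (D.label e.2) *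
          t (D.label e.1) ^ 4) := by
        rw [hs, Finset.prod_disjSum]
        gcongr with v hv e he
        · exact (S.lintegral_nodeInd D v).le
        · have hrev := hF.mReversible e he
          exact (S.lintegral_arcFactor_le hrev.1 (hδ _ _ hrev.2).1.le (hδ_le _ _ hrev.2)).trans
            (ENNReal.ofReal_le_ofReal (hpair hrev.2).2.2.2)
    _ = ENNReal.ofReal ((∏ v, S.prob (D.label v)) * ∏ e ∈ F, t (D.label e.1) ^ 4) := by
        rw [hF.prod_eq, mul_assoc, ← Finset.prod_mul_distrib,
          ENNReal.ofReal_mul (Finset.prod_nonneg fun _ _ => hp0 _),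
          ENNReal.ofReal_prod_of_nonneg fun _ _ => hp0 _,
          ENNReal.ofReal_prod_of_nonneg fun e he => mul_nonneg (mul_nonneg (hp0 _) (hp0 _))
            (pow_nonneg (hpair (hF.mReversible e he).2).1 _)]
    _ ≤ ENNReal.ofReal ((∏ v, S.prob (D.label v)) * ∏ v ∈ D.revNodes M, t (D.label v)) := by
        refine ENNReal.ofReal_le_ofReal (mul_le_mul_of_nonneg_left ?_
          (Finset.prod_nonneg fun _ _ => hp0 _))
        exact hF.prod_pow_four_le hM hmax (fun i i' h => (hpair h).1)
          (fun i i' h => (hpair h).2.1) (fun i i' h => (hpair h).2.2.1)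
    _ = ENNReal.ofReal (D.weight M S.prob (S.probReduced M δ)) := by
        rw [Wdag.weight, ← Finset.prod_compl_mul_prod (D.revNodes M), mul_assoc,
          ← Finset.prod_mul_distrib]
        congr 2
        refine Finset.prod_congr rfl fun v hv => ?_
        have hpos : 0 < S.prob (D.label v) := by
          simp only [Wdag.revNodes, Finset.mem_filter, Finset.mem_univ, true_and] at hv
          obtain ⟨u, hu | hu⟩ := hv
          · exact (hδ _ _ hu.2).1.trans_le (hδp' hu.2)
          · exact (hδ _ _ hu.2).1.trans_le (hδp hu.2)
        rw [ht, mul_div_cancel₀ _ hpos.ne']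

end VarSystem

/-! ### Extracting a resampling table from a run -/

theorem lintegral_infinitePi_update {I : Type*} [DecidableEq I] {Y : I → Type*}
    [∀ i, MeasurableSpace (Y i)] (ν : ∀ i, Measure (Y i)) [∀ i, IsProbabilityMeasure (ν i)] (i : I)
    {f : (∀ i, Y i) → ℝ≥0∞} (hf : Measurable f) :
    ∫⁻ y, f y ∂(Measure.infinitePi ν) =
      ∫⁻ y, ∫⁻ x, f (Function.update y i x) ∂(ν i) ∂(Measure.infinitePi ν) := by
  classical
  rw [lintegral_infinitePi_piecewise ν {i}ᶜ hf]
  refine lintegral_congr fun y => ?_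
  have hm : Measurable fun x => f (Function.update y i x) := hf.comp (measurable_update y)
  rw [← (measurePreserving_eval_infinitePi ν i).lintegral_comp hm]
  refine lintegral_congr fun z => congrArg f ?_
  funext k
  by_cases h : k = i
  · subst h; simp
  · simp [h]

namespace VarSystem

variable {ι : Type*} {κ : Type*} [Fintype κ] {X : κ → Type*} [∀ j, MeasurableSpace (X j)]
variable {R : Type*} [MeasurableSpace R]
variable (S : VarSystem ι X) (rule : S.SelectionRule R) (r : R) (ξ : ℕ → ∀ j, X j)

/-- The assignment at time `n`. -/
noncomputable def current (n : ℕ) : ∀ j, X j := S.history rule r ξ n (Fin.last n)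

/-- The run has not stopped at time `n`. -/
def Alive (n : ℕ) : Prop := ∃ i, S.current rule r ξ n ∈ S.event i

/-- The event selected at time `n`. It is of interest only if the run has not stopped. -/
noncomputable def selected (n : ℕ) : ι := rule.select n r (S.history rule r ξ n)

/-- The set of the variables which are resampled at time `n`. -/
def resampled (n : ℕ) : Set κ :=
  {j | S.Alive rule r ξ n ∧ j ∈ S.vbl (S.selected rule r ξ n)}

open Classical in
/-- The number of times at which a variable has been resampled before time `n`. -/
noncomputable def resampleCount : ℕ → κ → ℕ
  | 0, _ => 0
  | n + 1, j => resampleCount n j + if j ∈ S.resampled rule r ξ n then 1 else 0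

/-- The table of the samples used up to time `n`: the entry `(k, j)` is the `k`-th sample of the
variable `j`, or the entry of `τ` if there have been fewer samples of `j`. -/
noncomputable def runTable : ℕ → (∀ p : ℕ × κ, X p.2) → ∀ p : ℕ × κ, X p.2
  | 0, τ => writeRow Set.univ 0 (ξ 0) τ
  | n + 1, τ => runTable n (writeRow (S.resampled rule r ξ n)
      (S.resampleCount rule r ξ (n + 1)) (ξ (n + 1)) τ)

theorem current_mem_event {n : ℕ} (h : S.Alive rule r ξ n) :
    S.current rule r ξ n ∈ S.event (S.selected rule r ξ n) :=
  rule.select_holds n r _ h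

open Classical in
theorem current_succ (n : ℕ) : S.current rule r ξ (n + 1) =
    (S.resampled rule r ξ n).piecewise (ξ (n + 1)) (S.current rule r ξ n) := by
  funext j
  by_cases h : S.Alive rule r ξ n
  · have h' : ∃ i, S.history rule r ξ n (Fin.last n) ∈ S.event i := h
    by_cases hj : j ∈ S.vbl (S.selected rule r ξ n)
    · have hj' : j ∈ S.vbl (rule.select n r (S.history rule r ξ n)) := hj
      simp [current, history, h', resample, hj', Set.piecewise, resampled, hj, h]
    · have hj' : j ∉ S.vbl (rule.select n r (S.history rule r ξ n)) := hj
      simp [current, history, h', resample, hj', Set.piecewise, resampled, hj]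
  · have h' : ¬ ∃ i, S.history rule r ξ n (Fin.last n) ∈ S.event i := h
    simp [current, history, h', Set.piecewise, resampled, h]

theorem alive_of_alive_succ {n : ℕ} (h : S.Alive rule r ξ (n + 1)) : S.Alive rule r ξ n := by
  classical
  by_contra hn
  have : S.resampled rule r ξ n = ∅ := by
    ext j; simp [resampled, hn]
  have hc : S.current rule r ξ (n + 1) = S.current rule r ξ n := by
    rw [current_succ]
    funext j
    simp [this]
  exact hn (by rwa [Alive, hc] at h)

theorem alive_of_le {m n : ℕ} (hmn : m ≤ n) (h : S.Alive rule r ξ n) : S.Alive rule r ξ m := by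
  induction n, hmn using Nat.le_induction with
  | base => exact h
  | succ n _ ih => exact ih (S.alive_of_alive_succ rule r ξ h)

/-! ### Independence of future samples -/

theorem history_congr {ξ ξ' : ℕ → ∀ j, X j} {n : ℕ} (h : ∀ m ≤ n, ξ m = ξ' m) :
    S.history rule r ξ n = S.history rule r ξ' n := by
  induction n with
  | zero => rw [history, history, h 0 le_rfl]
  | succ n ih => rw [history, history, ih fun m hm => h m (hm.trans n.le_succ), h (n + 1) le_rfl]

theorem resampled_congr {ξ ξ' : ℕ → ∀ j, X j} {n : ℕ} (h : ∀ m ≤ n, ξ m = ξ' m) :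
    S.resampled rule r ξ n = S.resampled rule r ξ' n := by
  simp only [resampled, Alive, current, selected, S.history_congr rule r h]

theorem resampleCount_congr {ξ ξ' : ℕ → ∀ j, X j} {n : ℕ} (h : ∀ m < n, ξ m = ξ' m) :
    S.resampleCount rule r ξ n = S.resampleCount rule r ξ' n := by
  induction n with
  | zero => rfl
  | succ n ih =>
    funext j
    rw [resampleCount, resampleCount, ih fun m hm => h m (hm.trans n.lt_succ_self),
      S.resampled_congr rule r fun m hm => h m (Nat.lt_succ_of_le hm)]

theorem runTable_congr {ξ ξ' : ℕ → ∀ j, X j} {n : ℕ} (h : ∀ m ≤ n, ξ m = ξ' m) :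
    S.runTable rule r ξ n = S.runTable rule r ξ' n := by
  induction n with
  | zero => funext τ; simp only [runTable, h 0 le_rfl]
  | succ n ih =>
    have h' : ∀ m ≤ n, ξ m = ξ' m := fun m hm => h m (hm.trans n.le_succ)
    funext τ
    simp only [runTable, ih h', h (n + 1) le_rfl, S.resampled_congr rule r h',
      S.resampleCount_congr rule r fun m hm => h' m (Nat.lt_succ_iff.1 hm)]

/-! ### Reading the run off from its table -/

theorem resampleCount_le_succ (n : ℕ) (j : κ) :
    S.resampleCount rule r ξ n j ≤ S.resampleCount rule r ξ (n + 1) j := by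
  simp [resampleCount]

theorem runTable_of_lt {n k : ℕ} {j : κ} (h : S.resampleCount rule r ξ n j < k)
    (τ : ∀ p : ℕ × κ, X p.2) : S.runTable rule r ξ n τ (k, j) = τ (k, j) := by
  induction n generalizing τ with
  | zero =>
    have : k ≠ 0 := by simpa [resampleCount, Nat.pos_iff_ne_zero] using h
    simp [runTable, writeRow, this]
  | succ n ih =>
    rw [runTable, ih ((S.resampleCount_le_succ rule r ξ n j).trans_lt h)]
    simp [writeRow, h.ne']

/-- The assignments of the run can be read off from its table. -/
theorem runTable_resampleCount {n m : ℕ} (hm : m ≤ n) (j : κ) (τ : ∀ p : ℕ × κ, X p.2) :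
    S.runTable rule r ξ n τ (S.resampleCount rule r ξ m j, j) = S.current rule r ξ m j := by
  classical
  induction n generalizing τ m with
  | zero =>
    obtain rfl : m = 0 := by omega
    simp [runTable, writeRow, resampleCount, current, history]
  | succ n ih =>
    rw [runTable]
    rcases Nat.lt_or_eq_of_le hm with h | rfl
    · exact ih (Nat.lt_succ_iff.1 h) _
    · rw [current_succ]
      by_cases hj : j ∈ S.resampled rule r ξ n
      · have hlt : S.resampleCount rule r ξ n j < S.resampleCount rule r ξ (n + 1) j := by
          simp [resampleCount, hj]
        rw [S.runTable_of_lt rule r ξ hlt]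
        simp [writeRow, hj]
      · have heq : S.resampleCount rule r ξ (n + 1) j = S.resampleCount rule r ξ n j := by
          simp [resampleCount, hj]
        rw [heq, ih le_rfl]
        simp [hj]

theorem resampleCount_eq_logCount {n : ℕ} (h : ∀ m < n, S.Alive rule r ξ m) :
    S.resampleCount rule r ξ n = S.logCount (S.selected rule r ξ) n := by
  classical
  induction n with
  | zero => funext j; simp [resampleCount, logCount]
  | succ n ih =>
    funext j
    rw [resampleCount, ih fun m hm => h m (hm.trans n.lt_succ_self)]
    simp only [logCount]
    rw [Finset.range_add_one, Finset.filter_insert]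
    by_cases hj : j ∈ S.vbl (S.selected rule r ξ n)
    · simp [resampled, hj, h n n.lt_succ_self]
    · simp [resampled, hj]

open Classical in
/-- The number of resampling steps before time `N` is bounded by the expected number, over the
coins, of good proper witness DAGs. -/
theorem sum_alive_le (M : S.depGraph.Subgraph) (N : ℕ) (τ : ∀ p : ℕ × κ, X p.2) [Finite ι] :
    ∑ n ∈ Finset.range N, (if S.Alive rule r ξ n then 1 else 0 : ℝ≥0∞) ≤
      ∑' Q : PWdag S.depGraph,
        coinLaw ι {c | S.Good M Q.rep (S.runTable rule r ξ N τ) c} := by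
  have hex : ∀ N : ℕ, ∃ n ≤ N, (∀ m < n, S.Alive rule r ξ m) ∧
      ∑ n ∈ Finset.range N, (if S.Alive rule r ξ n then 1 else 0 : ℝ≥0∞) ≤ n := by
    intro N
    induction N with
    | zero => exact ⟨0, le_rfl, by simp, by simp⟩
    | succ N ih =>
      by_cases h : S.Alive rule r ξ N
      · refine ⟨N + 1, le_rfl, fun m hm => S.alive_of_le rule r ξ (Nat.lt_succ_iff.1 hm) h, ?_⟩
        refine (Finset.sum_le_card_nsmul _ _ 1 fun n _ => ?_).trans (by simp)
        split_ifs <;> simp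
      · obtain ⟨n, hn, hal, hle⟩ := ih
        exact ⟨n, hn.trans N.le_succ, hal, by rwa [Finset.sum_range_succ, if_neg h, add_zero]⟩
  obtain ⟨n, hn, hal, hle⟩ := hex N
  refine hle.trans ?_
  have hev : ∀ m < n, tableRow (S.logCount (S.selected rule r ξ) m) (S.runTable rule r ξ N τ) ∈
      S.event (S.selected rule r ξ m) := by
    intro m hm
    have : tableRow (S.logCount (S.selected rule r ξ) m) (S.runTable rule r ξ N τ) =
        S.current rule r ξ m := by
      rw [← S.resampleCount_eq_logCount rule r ξ fun m' hm' => hal m' (hm'.trans hm)]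
      exact funext fun j => S.runTable_resampleCount rule r ξ (hm.le.trans hn) j τ
    rw [this]
    exact S.current_mem_event rule r ξ (hal m hm)
  calc (n : ℝ≥0∞) = ∫⁻ _, n ∂(coinLaw ι) := by simp
    _ ≤ ∫⁻ c, ∑' Q : PWdag S.depGraph,
          {c | S.Good M Q.rep (S.runTable rule r ξ N τ) c}.indicator 1 c ∂(coinLaw ι) :=
        lintegral_mono fun c => S.card_le_tsum_good M c _ n hev
    _ = _ := by
        rw [lintegral_tsum (f := fun (Q : PWdag S.depGraph) c =>
          {c | S.Good M Q.rep (S.runTable rule r ξ N τ) c}.indicator 1 c) fun Q =>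
          (measurable_one.indicator (S.measurableSet_good M Q.rep _)).aemeasurable]
        exact tsum_congr fun Q => lintegral_indicator_one (S.measurableSet_good M Q.rep _)

/-! ### Measurability of the run -/

section Measurability

variable [Finite ι]

theorem measurableSet_alive_of_history {n : ℕ}
    (h : Measurable fun q : R × (ℕ → ∀ j, X j) => S.history rule q.1 q.2 n) :
    MeasurableSet {q : R × (ℕ → ∀ j, X j) | S.Alive rule q.1 q.2 n} := by
  have : {q : R × (ℕ → ∀ j, X j) | S.Alive rule q.1 q.2 n} =
      ⋃ i, (fun q : R × (ℕ → ∀ j, X j) => S.history rule q.1 q.2 n (Fin.last n)) ⁻¹' S.event i := by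
    ext q; simp [Alive, current]
  rw [this]
  exact MeasurableSet.iUnion fun i =>
    ((measurable_pi_apply _).comp h) (S.measurableSet_event i)

theorem measurableSet_resampled_of_history {n : ℕ}
    (h : Measurable fun q : R × (ℕ → ∀ j, X j) => S.history rule q.1 q.2 n) (j : κ) :
    MeasurableSet {q : R × (ℕ → ∀ j, X j) | j ∈ S.resampled rule q.1 q.2 n} := by
  have : {q : R × (ℕ → ∀ j, X j) | j ∈ S.resampled rule q.1 q.2 n} =
      {q | S.Alive rule q.1 q.2 n} ∩ ⋃ i ∈ {i | j ∈ S.vbl i},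
        (fun q : R × (ℕ → ∀ j, X j) => (q.1, S.history rule q.1 q.2 n)) ⁻¹'
          {q | rule.select n q.1 q.2 = i} := by
    ext q; simp [resampled, selected]
  rw [this]
  exact (S.measurableSet_alive_of_history rule h).inter
    (MeasurableSet.biUnion (Set.to_countable _) fun i _ =>
      (measurable_fst.prodMk h) (rule.measurableSet_select n i))

theorem measurable_history (n : ℕ) :
    Measurable fun q : R × (ℕ → ∀ j, X j) => S.history rule q.1 q.2 n := by
  classical
  induction n with
  | zero =>
    exact measurable_pi_lambda _ fun _ => (measurable_pi_apply 0).comp measurable_snd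
  | succ n ih =>
    refine measurable_pi_lambda _ fun m => ?_
    refine Fin.lastCases ?_ (fun m => ?_) m
    · change Measurable fun q : R × (ℕ → ∀ j, X j) => S.current rule q.1 q.2 (n + 1)
      simp_rw [current_succ]
      refine measurable_pi_lambda _ fun j => ?_
      refine Measurable.ite (S.measurableSet_resampled_of_history rule ih j) ?_ ?_
      · fun_prop
      · exact (measurable_pi_apply j).comp ((measurable_pi_apply (Fin.last n)).comp ih)
    · simp only [history, Fin.snoc_castSucc]
      exact (measurable_pi_apply m).comp ih

theorem measurableSet_alive (n : ℕ) :
    MeasurableSet {q : R × (ℕ → ∀ j, X j) | S.Alive rule q.1 q.2 n} :=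
  S.measurableSet_alive_of_history rule (S.measurable_history rule n)

theorem measurableSet_resampled (n : ℕ) (j : κ) :
    MeasurableSet {ξ : ℕ → ∀ j, X j | j ∈ S.resampled rule r ξ n} :=
  measurable_prodMk_left (S.measurableSet_resampled_of_history rule (S.measurable_history rule n) j)

theorem measurable_resampleCount (n : ℕ) (j : κ) :
    Measurable fun ξ : ℕ → ∀ j, X j => S.resampleCount rule r ξ n j := by
  classical
  induction n with
  | zero => exact measurable_const
  | succ n ih =>
    exact ih.add (Measurable.ite (S.measurableSet_resampled rule r n j) measurable_const
      measurable_const)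

theorem measurable_runTable (n : ℕ) :
    Measurable fun q : (ℕ → ∀ j, X j) × (∀ p : ℕ × κ, X p.2) => S.runTable rule r q.1 n q.2 := by
  classical
  induction n with
  | zero =>
    have h : Measurable fun q : (ℕ → ∀ j, X j) × (∀ p : ℕ × κ, X p.2) => (q.1 0, q.2) :=
      ((measurable_pi_apply 0).comp measurable_fst).prodMk measurable_snd
    exact (measurable_writeRow Set.univ 0).comp h
  | succ n ih =>
    suffices h : Measurable fun q : (ℕ → ∀ j, X j) × (∀ p : ℕ × κ, X p.2) =>
        writeRow (S.resampled rule r q.1 n) (S.resampleCount rule r q.1 (n + 1)) (q.1 (n + 1))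
          q.2 from ih.comp (measurable_fst.prodMk h)
    refine measurable_pi_lambda _ fun a => ?_
    refine Measurable.ite (MeasurableSet.inter ?_ ?_) ?_ ?_
    · exact measurable_fst (S.measurableSet_resampled rule r n a.2)
    · exact measurableSet_eq_fun measurable_const
        ((S.measurable_resampleCount rule r (n + 1) a.2).comp measurable_fst)
    · fun_prop
    · fun_prop

/-- The table of the samples used in a run, completed by independent samples, has the law of a
resampling table: each step of the run overwrites entries whose positions are determined by the
earlier samples. -/
theorem lintegral_runTable (n : ℕ) {g : (∀ p : ℕ × κ, X p.2) → ℝ≥0∞} (hg : Measurable g) :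
    ∫⁻ ξ, ∫⁻ τ, g (S.runTable rule r ξ n τ) ∂S.tableLaw ∂S.sampleLaw =
      ∫⁻ τ, g τ ∂S.tableLaw := by
  have hm (n : ℕ) : Measurable fun ξ => ∫⁻ τ, g (S.runTable rule r ξ n τ) ∂S.tableLaw :=
    Measurable.lintegral_prod_right' (hg.comp (S.measurable_runTable rule r n))
  induction n with
  | zero =>
    rw [sampleLaw, lintegral_infinitePi_update _ 0 (hm 0)]
    simp only [runTable, Function.update_self, S.lintegral_writeRow Set.univ 0 hg,
      lintegral_const, measure_univ, mul_one]
  | succ n ih =>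
    rw [← ih]
    conv_lhs => rw [sampleLaw, lintegral_infinitePi_update _ (n + 1) (hm (n + 1)), ← sampleLaw]
    refine lintegral_congr fun ξ => ?_
    have hu (x : ∀ j, X j) (m : ℕ) (h : m ≤ n) : Function.update ξ (n + 1) x m = ξ m :=
      Function.update_of_ne (by omega) _ _
    simp only [runTable, Function.update_self, S.runTable_congr rule r (hu _),
      S.resampled_congr rule r (hu _),
      S.resampleCount_congr rule r fun m hm => hu _ m (Nat.lt_succ_iff.1 hm)]
    exact S.lintegral_writeRow _ _
      (hg.comp ((S.measurable_runTable rule r n).comp measurable_prodMk_left))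

open Classical in
theorem expectedSteps_eq_tsum (ρ : Measure R) : S.expectedSteps rule ρ =
    ∑' n, ∫⁻ ω, (if S.Alive rule ω.1 ω.2 n then 1 else 0) ∂(ρ.prod S.sampleLaw) := by
  rw [← lintegral_tsum fun n => (Measurable.ite (S.measurableSet_alive rule n) measurable_const
    measurable_const).aemeasurable]
  refine lintegral_congr fun ω => ?_
  rw [numSteps, ← ENNReal.tsum_set_one, tsum_subtype _ fun _ => (1 : ℝ≥0∞)]
  rfl

end Measurability

end VarSystem

/-! ### The bound on the expected number of steps -/

theorem theorem3p6 {ι κ R : Type*} [Fintype ι] [Fintype κ] {X : κ → Type*}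
    [∀ j, MeasurableSpace (X j)] (S : VarSystem ι X)
    (M : S.depGraph.Subgraph) (hM : M.IsMatching)
    (δ : Sym2 ι → ℝ)
    (hδ : ∀ i i', M.Adj i i' → δ s(i, i') ∈ Set.Ioo (0 : ℝ) 1)
    (hδ_le : ∀ i i', M.Adj i i' → δ s(i, i') ≤ S.law.real (S.event i ∩ S.event i'))
    [MeasurableSpace R] (ρ : Measure R) [IsProbabilityMeasure ρ] (rule : S.SelectionRule R) :
    S.expectedSteps rule ρ ≤
      ∑' D : PWdag S.depGraph, ENNReal.ofReal (D.weight M S.prob (S.probReduced M δ)) := by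
  classical
  have hmeas (n : ℕ) : Measurable fun ω : R × (ℕ → ∀ j, X j) =>
      (if S.Alive rule ω.1 ω.2 n then 1 else 0 : ℝ≥0∞) :=
    Measurable.ite (S.measurableSet_alive rule n) measurable_const measurable_const
  have hgood (Q : PWdag S.depGraph) :
      Measurable fun τ => coinLaw ι {c | S.Good M Q.rep τ c} :=
    measurable_measure_prodMk_left (S.measurableSet_good_prod M Q.rep)
  have hW : Measurable fun τ => ∑' Q : PWdag S.depGraph, coinLaw ι {c | S.Good M Q.rep τ c} :=
    Measurable.tsum hgood
  rw [S.expectedSteps_eq_tsum rule ρ]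
  refine ENNReal.tsum_le_of_sum_range_le fun N => ?_
  rw [← lintegral_finsetSum _ fun n _ => hmeas n,
    lintegral_prod _ (Finset.measurable_fun_sum _ fun n _ => hmeas n).aemeasurable]
  calc ∫⁻ r, ∫⁻ ξ, ∑ n ∈ Finset.range N, (if S.Alive rule r ξ n then 1 else 0)
        ∂S.sampleLaw ∂ρ
      ≤ ∫⁻ r, ∫⁻ ξ, ∫⁻ τ, ∑' Q : PWdag S.depGraph,
          coinLaw ι {c | S.Good M Q.rep (S.runTable rule r ξ N τ) c}
          ∂S.tableLaw ∂S.sampleLaw ∂ρ := by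
        refine lintegral_mono fun r => lintegral_mono fun ξ => ?_
        refine le_trans ?_ (lintegral_mono fun τ => S.sum_alive_le rule r ξ M N τ)
        simp
    _ = ∑' Q : PWdag S.depGraph, ∫⁻ τ, coinLaw ι {c | S.Good M Q.rep τ c} ∂S.tableLaw := by
        simp only [S.lintegral_runTable rule _ N hW, lintegral_const, measure_univ, mul_one]
        exact lintegral_tsum fun Q => (hgood Q).aemeasurable
    _ ≤ _ := by
        refine ENNReal.tsum_le_tsum fun Q => ?_
        rw [Q.weight_eq_rep]
        exact S.lintegral_coinLaw_good_le hM hδ hδ_le Q.rep
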